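/- **Setting.** Let $W:[0,1]^2\to[0,1]$ be a graphon (measurable and symmetric) that is piecewise Lipschitz: there are a constant $L$, an integer $K\ge 0$ and points $0=\alpha_0<\dots<\alpha_{K+1}=1$ such that, with $I_k=[\alpha_{k-1},\alpha_k)$, for all $k,\ell$ and all $(x_1,y_1),(x_2,y_2)\in I_k\times I_\ell$, $$|W(x_1,y_1)-W(x_2,y_2)|\le L(|x_1-x_2|+|y_1-y_2|).$$ Put $\eta_W=\inf_{[0,1]^2} W$, $d(x)=\int_0^1 W(x,y)\,dy$, $\delta_W=\inf_x d(x)$, $(T_Wf)(x)=\int_0^1W(x,y)f(y)\,dy$, and let $\|T_W\|$ be the operator norm of $T_W$ on $L^2[0,1]$. Assume $\eta_W>0$. A graph $G_N$ with vertices $1,\dots,N$ is sampled from $W$ as follows: $X_1,\dots,X_N$ are independent and uniform on $[0,1]$ with order statistics $X_{(1)}\le\dots\le X_{(N)}$, and, given these, each pair $i\ne j$ is connected with probability $W(X_{(i)},X_{(j)})$, independently of the other pairs. Its average effective resistance is $R_N^{\mathrm{ave}}=\frac1{2N^2}\sum_{i,j=1}^N R_{\mathrm{eff}}(i,j)$,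 where $R_{\mathrm{eff}}(i,j)$ is the effective resistance between $i$ and $j$ when all edges have unit resistance ($\infty$ if $i$ and $j$ are not connected). Let $R_{W,N}^{\mathrm{ave}}=\frac1N\int_0^1\frac{dx}{d(x)}$ and $$b_N=\tfrac1N+\sqrt{\tfrac{8\log(N/\nu)}{N+1}},\qquad \vartheta(N)=2\sqrt{(L^2-K^2)b_N^2+Kb_N},\qquad \phi(N)=\sqrt{\tfrac{4\log(2N/\nu)}{N}}+\vartheta(N),$$ $$\gamma(N)=\sqrt{\tfrac{\log(2N/\nu)}{N\eta_W}},\qquad \varphi(N)=\Big(\tfrac1{\sqrt{\eta_W}}+2\Big)\sqrt{\tfrac{\log(2N/\nu)}{N}}$$ (where $\sqrt t=0$ for $t<0$), and $$E(N,\nu)=\frac{1}{N(\eta_W-\gamma(N))}\left(\frac1N+\frac{\phi(N)}{\delta_W}+\frac{\sqrt[4]{2}\,\sqrt{\|T_W\|+\phi(N)}}{N^{1/4}(\eta_W-\varphi(N))}\right).$$ **Theorem.** (i) Let $0<\nu<e^{-1}$ and let $N\ge1$ satisfy $$\frac2N<\min_k(\alpha_k-\alpha_{k-1}),\qquad \frac1N\log\frac{2N}\nu+\frac{2K+3L}{N}<\sup_x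 d(x),\qquad Ne^{-N/5}<\nu,\qquad \varphi(N)<\eta_W$$ (the last condition is equivalent to $\frac{\log(2N/\nu)}{N}<\frac{\eta_W^3}{(1+2\sqrt{\eta_W})^2}$ and implies $\gamma(N)<\eta_W$). Then, with probability at least $1-3\nu$, $R_N^{\mathrm{ave}}$ is finite and $$\left|R_N^{\mathrm{ave}}-R_{W,N}^{\mathrm{ave}}\right|\le E(N,\nu).$$ (ii) As $N\to\infty$, $E(N,\nu)=O\big((\log N/N^5)^{1/4}\big)$, both for every constant $\nu\in(0,e^{-1})$ and for $\nu=N^{-a}$ with any constant $a>0$. -/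

import Mathlib

noncomputable section

namespace Graphon

open MeasureTheory ProbabilityTheory
open scoped unitInterval ENNReal

/-- `W : [0,1]² → ℝ` is a graphon: measurable, symmetric, with values in `[0,1]`. -/
structure IsGraphon (W : I → I → ℝ) : Prop where
  measurable : Measurable (Function.uncurry W)
  symm : ∀ x y, W x y = W y x
  nonneg : ∀ x y, 0 ≤ W x y
  le_one : ∀ x y, W x y ≤ 1

/-- `W` is Lipschitz with constant `L` on every block `I_k × I_ℓ`, where
`0 = α_0 < ⋯ < α_{K+1} = 1` and `I_k = [α_{k-1}, α_k)`. -/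
structure IsPiecewiseLipschitz (W : I → I → ℝ) (K : ℕ) (α : Fin (K + 2) → ℝ) (L : ℝ) : Prop where
  strictMono : StrictMono α
  first : α 0 = 0
  last : α (Fin.last (K + 1)) = 1
  lipschitz : ∀ k l : Fin (K + 1), ∀ x₁ y₁ x₂ y₂ : I,
    (x₁ : ℝ) ∈ Set.Ico (α k.castSucc) (α k.succ) → (y₁ : ℝ) ∈ Set.Ico (α l.castSucc) (α l.succ) →
    (x₂ : ℝ) ∈ Set.Ico (α k.castSucc) (α k.succ) → (y₂ : ℝ) ∈ Set.Ico (α l.castSucc) (α l.succ) →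
    |W x₁ y₁ - W x₂ y₂| ≤ L * (|(x₁ : ℝ) - x₂| + |(y₁ : ℝ) - y₂|)

/-- The infimum `η_W` of `W` over `[0,1]²`. -/
def eta (W : I → I → ℝ) : ℝ := ⨅ p : I × I, W p.1 p.2

/-- The degree function `d(x) = ∫₀¹ W(x,y) dy`. -/
def degree (W : I → I → ℝ) (x : I) : ℝ := ∫ y : I, W x y

/-- The infimum `δ_W` of the degree function. -/
def minDegree (W : I → I → ℝ) : ℝ := ⨅ x : I, degree W x

/-- The supremum of the degree function. -/
def maxDegree (W : I → I → ℝ) : ℝ := ⨆ x : I, degree W x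

/-- The integral operator `(T_W f)(x) = ∫₀¹ W(x,y) f(y) dy`. -/
def integralOp (W : I → I → ℝ) (f : I → ℝ) (x : I) : ℝ := ∫ y : I, W x y * f y

/-- The operator norm of `T_W` on `L²[0,1]`. -/
def opNorm (W : I → I → ℝ) : ℝ :=
  sSup {r : ℝ | ∃ f : I → ℝ, MemLp f 2 volume ∧ eLpNorm f 2 volume = 1 ∧
    r = (eLpNorm (integralOp W f) 2 volume).toReal}

/-! ### Sampled graphs -/

/-- The order statistics `x_(1) ≤ ⋯ ≤ x_(N)` of a tuple of points of `[0,1]`. -/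
def orderStat {N : ℕ} (x : Fin N → I) : Fin N → I := x ∘ Tuple.sort x

open Classical in
/-- The probability of obtaining exactly the graph `H` when each pair `i < j` is connected,
independently of all the others, with probability `W(x_(i), x_(j))`. -/
def graphProb (W : I → I → ℝ) {N : ℕ} (x : Fin N → I) (H : SimpleGraph (Fin N)) : ℝ :=
  ∏ p ∈ (Finset.univ : Finset (Fin N × Fin N)).filter (fun p => p.1 < p.2),
    if H.Adj p.1 p.2 then W (orderStat x p.1) (orderStat x p.2)
    else 1 - W (orderStat x p.1) (orderStat x p.2)

/-- `G` is a random simple graph with `N` vertices sampled from `W`: the `X i` are independent and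
uniform on `[0,1]`, and given `X` the edges of `G` are drawn independently, the pair `i ≠ j` with
probability `W(X_(i), X_(j))`. -/
structure IsSampledGraph (W : I → I → ℝ) (N : ℕ) {Ω : Type*} [MeasurableSpace Ω]
    (P : Measure Ω) (X : Fin N → Ω → I) (G : Ω → SimpleGraph (Fin N)) : Prop where
  measurable_latent : ∀ i, Measurable (X i)
  indep_latent : iIndepFun X P
  uniform_latent : ∀ i, P.map (X i) = volume
  measurable_graph : ∀ H, MeasurableSet {ω | G ω = H}
  law_given_latent : ∀ (H : SimpleGraph (Fin N)) (B : Set (Fin N → I)), MeasurableSet B →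
    P ({ω | (fun i => X i ω) ∈ B} ∩ {ω | G ω = H}) =
      ∫⁻ ω in {ω | (fun i => X i ω) ∈ B}, ENNReal.ofReal (graphProb W (fun i => X i ω) H) ∂P

/-! ### Effective resistance -/

open Classical in
/-- The effective resistance between `i` and `j` when every edge has unit resistance: the potential
difference `v i - v j` for a potential `v` that balances a unit current injected in `i` and
extracted from `j`, that is, solves `L v = e_i - e_j` with `L` the graph Laplacian. All solutions
give the same potential difference; the value is `∞` if there is none, that is, if `i` and `j` are
in different connected components. -/
def effectiveResistance {N : ℕ} (G : SimpleGraph (Fin N)) (i j : Fin N) : ℝ≥0∞ :=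
  ⨅ (v : Fin N → ℝ) (_ : (G.lapMatrix ℝ).mulVec v = Pi.single i 1 - Pi.single j 1),
    ENNReal.ofReal (v i - v j)

/-- The average effective resistance `(1/(2N²)) ∑ᵢ ∑ⱼ R_eff(i,j)`. -/
def averageResistance {N : ℕ} (G : SimpleGraph (Fin N)) : ℝ≥0∞ :=
  (∑ i, ∑ j, effectiveResistance G i j) / (2 * (N : ℝ≥0∞) ^ 2)

/-- The graphon approximation `(1/N) ∫₀¹ 1/d(x) dx`. -/
def graphonResistance (W : I → I → ℝ) (N : ℕ) : ℝ := 1 / (N : ℝ) * ∫ x : I, 1 / degree W x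

/-! ### The quantities in the error bound -/

/-- `b_N = 1/N + √(8 log(N/ν)/(N+1))`. -/
def bN (N : ℕ) (ν : ℝ) : ℝ := 1 / (N : ℝ) + √(8 * Real.log (N / ν) / (N + 1))

/-- `ϑ(N) = 2 √((L² - K²) b_N² + K b_N)`. -/
def vartheta (K : ℕ) (L : ℝ) (N : ℕ) (ν : ℝ) : ℝ :=
  2 * √((L ^ 2 - (K : ℝ) ^ 2) * bN N ν ^ 2 + K * bN N ν)

/-- `ϕ(N) = √(4 log(2N/ν)/N) + ϑ(N)`. -/
def phi (K : ℕ) (L : ℝ) (N : ℕ) (ν : ℝ) : ℝ :=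
  √(4 * Real.log (2 * N / ν) / N) + vartheta K L N ν

/-- `γ(N) = √(log(2N/ν)/(N η_W))`. -/
def gamma (W : I → I → ℝ) (N : ℕ) (ν : ℝ) : ℝ := √(Real.log (2 * N / ν) / (N * eta W))

/-- `φ(N) = (1/√η_W + 2) √(log(2N/ν)/N)`. -/
def varphi (W : I → I → ℝ) (N : ℕ) (ν : ℝ) : ℝ :=
  (1 / √(eta W) + 2) * √(Real.log (2 * N / ν) / N)

/-- The bound on the error of the graphon approximation. -/
def errorBound (W : I → I → ℝ) (K : ℕ) (L : ℝ) (N : ℕ) (ν : ℝ) : ℝ :=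
  1 / (N * (eta W - gamma W N ν)) *
    (1 / N + phi K L N ν / minDegree W +
      (2 : ℝ) ^ (1 / 4 : ℝ) * √(opNorm W + phi K L N ν) /
        ((N : ℝ) ^ (1 / 4 : ℝ) * (eta W - varphi W N ν)))

end Graphon

end

/-! For a connected graph, `N` times the average resistance is the trace of the pseudoinverse of the
Laplacian. Adding κ times the all-ones matrix gives an invertible matrix M, and adds exactly 1/(κN)
to that trace. So the task is to show that the diagonal of M⁻¹ is close to the inverse degrees.

The vector M⁻¹e_i - e_i/M_ii has energy (M⁻¹)_ii - 1/M_ii. This is nonnegative, and at most the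
squared norm of the residual divided by a coercivity constant c of M. The residual is an
off-diagonal column divided by M_ii, with squared norm O(1/N), while c is of order N; so the trace
is off by O(1/N) only (`averageResistance_sub_sum_inv_deg`). The bound on c needs no matrix
concentration: since W ≥ η, any two vertices have of order η²N common neighbours, and paths of
length two compare the Dirichlet form with that of the complete graph.

What remains is the sum of the inverse degrees. Put s = √(log(2N/ν)/N). Given X_a, the degree of
vertex a is binomial with N - 1 trials and mean (N - 1)d(X_a), so Hoeffding puts all degrees within
Ns of N d(X_a). A second Hoeffding bound compares the average of 1/d(X_a) with its integral. Each
step costs at most s/((η - γ)δ), and the term 2s of ϕ(N) pays for both; the term with N^(1/4) pays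
for the spectral error. The three exceptional events (degrees, common neighbours, average of 1/d)
have probability at most ν each. -/

namespace Graphon

/-! ### Diagonal of the inverse of a coercive matrix. -/

section Coercive

open Matrix

variable {n : Type*} [Fintype n] [DecidableEq n]

/-- A symmetric matrix whose quadratic form dominates `c` times the square norm. -/
structure IsCoercive (M : Matrix n n ℝ) (c : ℝ) : Prop where
  symm : Mᵀ = M
  pos : 0 < c
  le : ∀ x : n → ℝ, c * (x ⬝ᵥ x) ≤ x ⬝ᵥ M *ᵥ x

namespace IsCoercive

variable {M : Matrix n n ℝ} {c : ℝ}

theorem isUnit_det (h : IsCoercive M c) : IsUnit M.det := by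
  rw [← Matrix.isUnit_iff_isUnit_det, ← Matrix.mulVec_injective_iff_isUnit]
  rw [← Matrix.coe_mulVecLin, ← LinearMap.ker_eq_bot, LinearMap.ker_eq_bot']
  intro x hx
  have h1 := h.le x
  have hx' : M *ᵥ x = 0 := hx
  rw [hx', dotProduct_zero] at h1
  have h2 : x ⬝ᵥ x = 0 :=
    le_antisymm (by nlinarith [h.pos]) (Finset.sum_nonneg fun i _ => mul_self_nonneg _)
  exact dotProduct_self_eq_zero.1 h2

theorem mulVec_inv (h : IsCoercive M c) (v : n → ℝ) : M *ᵥ (M⁻¹ *ᵥ v) = v := by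
  rw [mulVec_mulVec, mul_nonsing_inv _ h.isUnit_det, one_mulVec]

theorem inv_mulVec (h : IsCoercive M c) (v : n → ℝ) : M⁻¹ *ᵥ (M *ᵥ v) = v := by
  rw [mulVec_mulVec, nonsing_inv_mul _ h.isUnit_det, one_mulVec]

theorem inv_symm (h : IsCoercive M c) (i j : n) : M⁻¹ i j = M⁻¹ j i := by
  have : (M⁻¹)ᵀ = M⁻¹ := by rw [transpose_nonsing_inv, h.symm]
  exact congrFun (congrFun this j) i

theorem diag_ge (h : IsCoercive M c) (i : n) : c ≤ M i i := by
  have := h.le (Pi.single i 1)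
  simpa using this

theorem dotProduct_comm {n : Type*} [Fintype n] {M : Matrix n n ℝ} {c : ℝ}
    (h : IsCoercive M c) (x y : n → ℝ) : x ⬝ᵥ M *ᵥ y = y ⬝ᵥ M *ᵥ x := by
  rw [dotProduct_mulVec, ← mulVec_transpose, h.symm, _root_.dotProduct_comm]

/-- The energy of the `i`-th column of the inverse, compared with that of `e_i / M i i`. -/
theorem energy_diff (h : IsCoercive M c) (i : n) :
    (M⁻¹ *ᵥ Pi.single i 1 - (1 / M i i) • Pi.single i 1) ⬝ᵥ
      M *ᵥ (M⁻¹ *ᵥ Pi.single i 1 - (1 / M i i) • Pi.single i 1) = M⁻¹ i i - 1 / M i i := by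
  have hM : M i i ≠ 0 := (h.pos.trans_le (h.diag_ge i)).ne'
  rw [mulVec_sub, mulVec_smul, h.mulVec_inv]
  simp only [sub_dotProduct, dotProduct_sub, smul_dotProduct, dotProduct_smul]
  rw [h.dotProduct_comm, h.mulVec_inv]
  simp only [mulVec_single, MulOpposite.op_one, one_smul, dotProduct_single, single_dotProduct,
    one_mul, mul_one, col_apply, Pi.single_eq_same, smul_eq_mul]
  rw [one_div_mul_cancel hM]
  ring

theorem one_div_le_inv_diag (h : IsCoercive M c) (i : n) : 1 / M i i ≤ M⁻¹ i i := by
  have h1 := h.energy_diff i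
  have h2 := h.le (M⁻¹ *ᵥ Pi.single i 1 - (1 / M i i) • Pi.single i 1)
  have h3 : 0 ≤ c * ((M⁻¹ *ᵥ Pi.single i 1 - (1 / M i i) • Pi.single i 1) ⬝ᵥ
      (M⁻¹ *ᵥ Pi.single i 1 - (1 / M i i) • Pi.single i 1)) :=
    mul_nonneg h.pos.le (Finset.sum_nonneg fun i _ => mul_self_nonneg _)
  linarith

/-- The residual r = M z is, off the diagonal, column i divided by -M i i, and it vanishes at i.
Coercivity bounds the energy z · r by |r|²/c. -/
theorem inv_diag_le (h : IsCoercive M c) (i : n) :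
    M⁻¹ i i ≤ 1 / M i i + (∑ k ∈ Finset.univ.erase i, M k i ^ 2) / (c * M i i ^ 2) := by
  have hM : M i i ≠ 0 := (h.pos.trans_le (h.diag_ge i)).ne'
  have h1 := h.energy_diff i
  set z := M⁻¹ *ᵥ Pi.single i 1 - (1 / M i i) • Pi.single i 1 with hz
  have h2 := h.le z
  set r := M *ᵥ z with hr
  have hr' : ∀ k, r k = if k = i then 0 else - (M k i / M i i) := by
    intro k
    rw [hr, hz, mulVec_sub, mulVec_smul, h.mulVec_inv]
    by_cases hk : k = i
    · subst hk; simp [hM]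
    · simp [hk]; ring
  have h3 : r ⬝ᵥ r = (∑ k ∈ Finset.univ.erase i, M k i ^ 2) / M i i ^ 2 := by
    rw [dotProduct, ← Finset.add_sum_erase _ _ (Finset.mem_univ i), hr' i, Finset.sum_div]
    simp only [if_true, mul_zero, zero_add]
    refine Finset.sum_congr rfl fun k hk => ?_
    rw [hr', if_neg (Finset.ne_of_mem_erase hk)]
    ring
  have hc := h.pos
  -- Expand |c z - r|² ≥ 0; with c|z|² ≤ z · r one copy of c (z · r) cancels.
  have h4 : 2 * c * (z ⬝ᵥ r) ≤ c ^ 2 * (z ⬝ᵥ z) + r ⬝ᵥ r := by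
    simp only [dotProduct, Finset.mul_sum, ← Finset.sum_add_distrib]
    refine Finset.sum_le_sum fun k _ => ?_
    nlinarith [sq_nonneg (c * z k - r k)]
  have h5 : c * (z ⬝ᵥ r) ≤ r ⬝ᵥ r := by nlinarith
  rw [h1, h3] at h5
  have h6 : M⁻¹ i i - 1 / M i i ≤ (∑ k ∈ Finset.univ.erase i, M k i ^ 2) / M i i ^ 2 / c := by
    rw [le_div_iff₀ hc]; linarith
  rw [div_div, mul_comm (M i i ^ 2)] at h6
  linarith

end IsCoercive

end Coercive

/-! ### Shifted Laplacian, spectral gap and effective resistance. -/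

section Graph

open Matrix

variable {N : ℕ}

open Classical in
/-- The adjacency indicator with real values. -/
noncomputable def adj (G : SimpleGraph (Fin N)) (i j : Fin N) : ℝ := if G.Adj i j then 1 else 0

/-- The degree of a vertex, as a real number. -/
noncomputable def deg (G : SimpleGraph (Fin N)) (i : Fin N) : ℝ := ∑ j, adj G i j

/-- The number of common neighbours of two vertices, as a real number. -/
noncomputable def codeg (G : SimpleGraph (Fin N)) (i j : Fin N) : ℝ := ∑ k, adj G i k * adj G j k

theorem adj_symm (G : SimpleGraph (Fin N)) (i j : Fin N) : adj G i j = adj G j i := by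
  by_cases h : G.Adj i j
  · simp [adj, h, h.symm]
  · have h' : ¬ G.Adj j i := fun h' => h h'.symm
    simp [adj, h, h']

@[simp] theorem adj_self (G : SimpleGraph (Fin N)) (i : Fin N) : adj G i i = 0 := by simp [adj]

theorem adj_nonneg (G : SimpleGraph (Fin N)) (i j : Fin N) : 0 ≤ adj G i j := by
  unfold adj; split_ifs <;> norm_num

theorem adj_sq (G : SimpleGraph (Fin N)) (i j : Fin N) : adj G i j ^ 2 = adj G i j := by
  unfold adj; split_ifs <;> norm_num

theorem adj_le_one (G : SimpleGraph (Fin N)) (i j : Fin N) : adj G i j ≤ 1 := by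
  unfold adj; split_ifs <;> norm_num

theorem deg_le (G : SimpleGraph (Fin N)) (i : Fin N) : deg G i ≤ N := by
  refine (Finset.sum_le_sum fun j _ => adj_le_one G i j).trans ?_
  simp

/-- The Laplacian shifted by a multiple of the all-ones matrix. -/
noncomputable def shiftedLap (G : SimpleGraph (Fin N)) (κ : ℝ) : Matrix (Fin N) (Fin N) ℝ :=
  Matrix.of fun i j => (if i = j then deg G i else 0) - adj G i j + κ

theorem shiftedLap_mulVec (G : SimpleGraph (Fin N)) (κ : ℝ) (v : Fin N → ℝ) (i : Fin N) :
    (shiftedLap G κ *ᵥ v) i = deg G i * v i - ∑ j, adj G i j * v j + κ * ∑ j, v j := by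
  simp only [shiftedLap, mulVec, dotProduct, of_apply, add_mul, sub_mul, Finset.sum_add_distrib,
    Finset.sum_sub_distrib, Finset.mul_sum, ite_mul, zero_mul, Finset.sum_ite_eq,
    Finset.mem_univ, if_true]

theorem shiftedLap_transpose (G : SimpleGraph (Fin N)) (κ : ℝ) :
    (shiftedLap G κ)ᵀ = shiftedLap G κ := by
  ext i j
  simp only [transpose_apply, shiftedLap, of_apply, adj_symm G j i]
  by_cases h : i = j
  · simp [h]
  · simp [h, Ne.symm h]

theorem sum_adj_mul_sq_sub (G : SimpleGraph (Fin N)) (x : Fin N → ℝ) :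
    ∑ i, ∑ j, adj G i j * (x i - x j) ^ 2 =
      2 * (∑ i, x i * (deg G i * x i - ∑ j, adj G i j * x j)) := by
  have e1 : ∑ i, ∑ j, adj G i j * x j ^ 2 = ∑ i, ∑ j, adj G i j * x i ^ 2 := by
    rw [Finset.sum_comm]
    exact Finset.sum_congr rfl fun i _ => Finset.sum_congr rfl fun j _ => by rw [adj_symm]
  have e2 : ∀ i j, adj G i j * (x i - x j) ^ 2 =
      adj G i j * x i ^ 2 + adj G i j * x j ^ 2 - 2 * (x i * (adj G i j * x j)) := by
    intros; ring
  simp only [e2, Finset.sum_sub_distrib, Finset.sum_add_distrib, e1, mul_sub, ← Finset.mul_sum,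
    deg, Finset.sum_mul]
  have e3 : ∀ i, x i * ∑ j, adj G i j * x i = ∑ j, adj G i j * x i ^ 2 := by
    intro i; rw [Finset.mul_sum]; exact Finset.sum_congr rfl fun j _ => by ring
  simp only [e3]; ring

/-- Group the paths i-k-j by their centre k. With y_i = x_k - x_i, the sum of (y_i - y_j)² over
neighbours of k is 2 deg k ∑ y_i² minus twice a square, and deg k ≤ N. -/
theorem sum_codeg_mul_sq_sub_le (G : SimpleGraph (Fin N)) (x : Fin N → ℝ) :
    ∑ i, ∑ j, codeg G i j * (x i - x j) ^ 2 ≤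
      2 * N * ∑ i, ∑ j, adj G i j * (x i - x j) ^ 2 := by
  have e1 : ∑ i, ∑ j, codeg G i j * (x i - x j) ^ 2 =
      ∑ k, ∑ i, ∑ j, adj G k i * adj G k j * (x i - x j) ^ 2 := by
    simp only [codeg, Finset.sum_mul]
    rw [Finset.sum_comm' (s := Finset.univ) (t := fun _ => Finset.univ) (t' := Finset.univ)
      (s' := fun _ => Finset.univ) (by simp)]
    rw [Finset.sum_congr rfl fun j _ => Finset.sum_comm]
    rw [Finset.sum_comm]
    refine Finset.sum_congr rfl fun k _ => ?_
    rw [Finset.sum_comm]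
    refine Finset.sum_congr rfl fun i _ => Finset.sum_congr rfl fun j _ => ?_
    rw [adj_symm G k i, adj_symm G k j]
  rw [e1, Finset.mul_sum]
  refine Finset.sum_le_sum fun k _ => ?_
  have e2 : ∑ i, ∑ j, adj G k i * adj G k j * (x i - x j) ^ 2 =
      2 * (deg G k * ∑ i, adj G k i * (x k - x i) ^ 2) - 2 * (∑ i, adj G k i * (x k - x i)) ^ 2 := by
    have e3 : ∀ i j, adj G k i * adj G k j * (x i - x j) ^ 2 =
        (adj G k i * (x k - x i) ^ 2) * adj G k j + adj G k i * (adj G k j * (x k - x j) ^ 2)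
          - 2 * ((adj G k i * (x k - x i)) * (adj G k j * (x k - x j))) := by intros; ring
    simp only [e3, Finset.sum_sub_distrib, Finset.sum_add_distrib, ← Finset.mul_sum,
      ← Finset.sum_mul, deg]
    ring
  rw [e2]
  have h1 : 0 ≤ ∑ i, adj G k i * (x k - x i) ^ 2 :=
    Finset.sum_nonneg fun i _ => mul_nonneg (adj_nonneg _ _ _) (sq_nonneg _)
  have h2 := mul_le_mul_of_nonneg_right (deg_le G k) h1
  nlinarith [sq_nonneg (∑ i, adj G k i * (x k - x i))]

/-- Many common neighbours force a spectral gap of the Laplacian. -/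
theorem isCoercive_shiftedLap {G : SimpleGraph (Fin N)} {m κ : ℝ} (hN : 0 < N) (hm : 0 < m)
    (hG : ∀ i j, i ≠ j → m ≤ codeg G i j) (hκ : m / (2 * N) ≤ κ) :
    IsCoercive (shiftedLap G κ) (m / 2) where
  symm := shiftedLap_transpose G κ
  pos := by positivity
  le x := by
    have hN' : (0 : ℝ) < N := by exact_mod_cast hN
    have h1 : m * ∑ i, ∑ j, (x i - x j) ^ 2 ≤ ∑ i, ∑ j, codeg G i j * (x i - x j) ^ 2 := by
      simp only [Finset.mul_sum]
      refine Finset.sum_le_sum fun i _ => Finset.sum_le_sum fun j _ => ?_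
      by_cases hij : i = j
      · simp [hij]
      · exact mul_le_mul_of_nonneg_right (hG i j hij) (sq_nonneg _)
    have h2 : ∑ i, ∑ j, (x i - x j) ^ 2 = 2 * N * ∑ i, x i ^ 2 - 2 * (∑ i, x i) ^ 2 := by
      have e : ∀ i j, (x i - x j) ^ 2 = x i ^ 2 + x j ^ 2 - 2 * (x i * x j) := by intros; ring
      simp only [e, Finset.sum_sub_distrib, Finset.sum_add_distrib, ← Finset.mul_sum,
        ← Finset.sum_mul, Finset.sum_const, Finset.card_univ, Fintype.card_fin, nsmul_eq_mul]
      ring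
    have h3 := sum_codeg_mul_sq_sub_le G x
    rw [sum_adj_mul_sq_sub] at h3
    have h4 : x ⬝ᵥ shiftedLap G κ *ᵥ x =
        ∑ i, x i * (deg G i * x i - ∑ j, adj G i j * x j) + κ * (∑ i, x i) ^ 2 := by
      simp only [dotProduct, shiftedLap_mulVec, mul_add, Finset.sum_add_distrib]
      rw [← Finset.sum_mul]; ring
    have h5 : x ⬝ᵥ x = ∑ i, x i ^ 2 := Finset.sum_congr rfl fun i _ => by ring
    rw [h4, h5]
    set Q := ∑ i, x i * (deg G i * x i - ∑ j, adj G i j * x j)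
    set S := ∑ i, x i ^ 2
    set T := (∑ i, x i) ^ 2 with hT
    have hT0 : 0 ≤ T := sq_nonneg _
    have h6 : m * (2 * N * S - 2 * T) ≤ 2 * N * (2 * Q) := by
      rw [← h2]; exact h1.trans h3
    have h7 := mul_le_mul_of_nonneg_right hκ hT0
    -- The complete-graph form loses a multiple of (∑ x)² in the direction of constants; `hκ` lets
    -- the shift make up for it.
    have h8 : m / 2 * S ≤ Q + m / (2 * N) * T := by
      have : m / 2 * S - m / (2 * N) * T = (m * (2 * N * S - 2 * T)) / (2 * N * 2) := by
        field_simp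
      have h9 : (m * (2 * N * S - 2 * T)) / (2 * N * 2) ≤ Q := by
        rw [div_le_iff₀ (by positivity)]; linarith
      linarith
    linarith

open Classical in
theorem lapMatrix_mulVec_eq (G : SimpleGraph (Fin N)) (v : Fin N → ℝ) (κ : ℝ) :
    (G.lapMatrix ℝ).mulVec v = shiftedLap G κ *ᵥ v - fun _ => κ * ∑ j, v j := by
  ext i
  rw [Pi.sub_apply, shiftedLap_mulVec, SimpleGraph.lapMatrix_mulVec_apply,
    SimpleGraph.degree_eq_sum_if_adj]
  simp only [deg, adj, SimpleGraph.neighborFinset_eq_filter, Finset.sum_filter, ite_mul, one_mul,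
    zero_mul]
  ring

/-- The Laplacian kills constants, so they form an eigenspace direction with eigenvalue κN. -/
theorem shiftedLap_mulVec_const (G : SimpleGraph (Fin N)) (κ a : ℝ) :
    shiftedLap G κ *ᵥ (fun _ => a) = fun _ => κ * (N * a) := by
  ext i
  rw [shiftedLap_mulVec]
  simp [deg, ← Finset.sum_mul]

theorem inv_mulVec_const {G : SimpleGraph (Fin N)} {κ c : ℝ} (hN : 0 < N) (hκ : 0 < κ)
    (h : IsCoercive (shiftedLap G κ) c) (a : ℝ) :
    (shiftedLap G κ)⁻¹ *ᵥ (fun _ => a) = fun _ => a / (κ * N) := by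
  have hN' : (0 : ℝ) < N := by exact_mod_cast hN
  rw [← h.inv_mulVec (fun _ => a / (κ * N)), shiftedLap_mulVec_const]
  congr 1
  ext i
  field_simp

/-- The shift is invisible on vectors of sum zero, so M⁻¹(e_i - e_j) is an admissible potential.
Every other one differs from it by a constant, so the infimum runs over equal values. -/
theorem effectiveResistance_eq {G : SimpleGraph (Fin N)} {κ c : ℝ} (hN : 0 < N) (hκ : 0 < κ)
    (h : IsCoercive (shiftedLap G κ) c) (i j : Fin N) :
    effectiveResistance G i j = ENNReal.ofReal ((shiftedLap G κ)⁻¹ i i + (shiftedLap G κ)⁻¹ j j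
      - 2 * (shiftedLap G κ)⁻¹ i j) := by
  have hN' : (0 : ℝ) < N := by exact_mod_cast hN
  set B := (shiftedLap G κ)⁻¹ with hB
  set e : Fin N → ℝ := Pi.single i 1 - Pi.single j 1 with he
  have hval : (B *ᵥ e) i - (B *ᵥ e) j = B i i + B j j - 2 * B i j := by
    have hs : B j i = B i j := h.inv_symm j i
    simp only [he, mulVec_sub, Pi.sub_apply, mulVec_single, MulOpposite.op_one, one_smul, col_apply]
    rw [hs]; ring
  -- M⁻¹ is symmetric and maps constants to constants, hence preserves the vectors of sum zero.
  have hsum : ∑ k, (B *ᵥ e) k = 0 := by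
    have h1 : (fun _ => (1 : ℝ)) ⬝ᵥ (B *ᵥ e) = e ⬝ᵥ (B *ᵥ fun _ => (1 : ℝ)) := by
      rw [dotProduct_mulVec, ← mulVec_transpose, dotProduct_comm]
      congr 2
      ext a b
      exact h.inv_symm b a
    have h2 : ∑ k, (B *ᵥ e) k = (fun _ => (1 : ℝ)) ⬝ᵥ (B *ᵥ e) := by simp [dotProduct]
    rw [h2, h1, inv_mulVec_const hN hκ h]
    simp [he, dotProduct, Finset.sum_sub_distrib, ← Finset.sum_mul]
  unfold effectiveResistance
  apply le_antisymm
  · refine (iInf₂_le (B *ᵥ e) ?_).trans (by rw [hval])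
    rw [lapMatrix_mulVec_eq G _ κ, h.mulVec_inv, hsum]
    ext k; simp [he]
  · refine le_iInf₂ fun v hv => ?_
    rw [lapMatrix_mulVec_eq G _ κ] at hv
    have h3 : shiftedLap G κ *ᵥ v = e + fun _ => κ * ∑ k, v k := by
      rw [he, ← hv]; simp
    have h4 := h.inv_mulVec v
    rw [h3, mulVec_add, inv_mulVec_const hN hκ h] at h4
    rw [← hval, ← h4]
    simp [hB]

/-- In the double sum of B i i + B j j - 2 B i j the diagonal yields 2N tr B, and all entries of B
add up to 1/κ because each row sums to 1/(κN). -/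
theorem toReal_averageResistance {G : SimpleGraph (Fin N)} {κ c : ℝ} (hN : 0 < N) (hκ : 0 < κ)
    (h : IsCoercive (shiftedLap G κ) c) :
    averageResistance G ≠ ⊤ ∧ N * (averageResistance G).toReal =
      ∑ i, (shiftedLap G κ)⁻¹ i i - 1 / (κ * N) := by
  have hN' : (0 : ℝ) < N := by exact_mod_cast hN
  set B := (shiftedLap G κ)⁻¹ with hB
  have hnn : ∀ i j, 0 ≤ B i i + B j j - 2 * B i j := by
    intro i j
    set z := B *ᵥ (Pi.single i 1 - Pi.single j 1) with hz
    have h1 := h.le z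
    have h2 : 0 ≤ z ⬝ᵥ z := Finset.sum_nonneg fun i _ => mul_self_nonneg _
    have h3 : z ⬝ᵥ shiftedLap G κ *ᵥ z = B i i + B j j - 2 * B i j := by
      have hs : B j i = B i j := h.inv_symm j i
      rw [hz, h.mulVec_inv]
      simp only [mulVec_sub, dotProduct_sub, mulVec_single, MulOpposite.op_one,
        one_smul, dotProduct_single, mul_one, Pi.sub_apply, col_apply]
      rw [hs]; ring
    rw [← h3]
    exact (mul_nonneg h.pos.le h2).trans h1
  have e1 : ∑ i, ∑ j, effectiveResistance G i j =
      ENNReal.ofReal (∑ i, ∑ j, (B i i + B j j - 2 * B i j)) := by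
    rw [ENNReal.ofReal_sum_of_nonneg fun i _ => Finset.sum_nonneg fun j _ => hnn i j]
    refine Finset.sum_congr rfl fun i _ => ?_
    rw [ENNReal.ofReal_sum_of_nonneg fun j _ => hnn i j]
    exact Finset.sum_congr rfl fun j _ => effectiveResistance_eq hN hκ h i j
  have e2 : ∑ i, ∑ j, B i j = 1 / κ := by
    have h5 := inv_mulVec_const hN hκ h 1
    have h6 : ∀ i, ∑ j, B i j = 1 / (κ * N) := by
      intro i
      have := congrFun h5 i
      simpa [mulVec, dotProduct] using this
    simp only [h6, Finset.sum_const, Finset.card_univ, Fintype.card_fin, nsmul_eq_mul]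
    field_simp
  have e3 : ∑ i, ∑ j, (B i i + B j j - 2 * B i j) = 2 * N * ∑ i, B i i - 2 * (1 / κ) := by
    simp only [Finset.sum_sub_distrib, Finset.sum_add_distrib, ← Finset.mul_sum, e2,
      Finset.sum_const, Finset.card_univ, Fintype.card_fin, nsmul_eq_mul]
    ring
  have h0 : 0 ≤ ∑ i, ∑ j, (B i i + B j j - 2 * B i j) :=
    Finset.sum_nonneg fun i _ => Finset.sum_nonneg fun j _ => hnn i j
  unfold averageResistance
  rw [e1]
  constructor
  · refine ENNReal.div_ne_top ENNReal.ofReal_ne_top ?_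
    simp [hN.ne']
  · rw [ENNReal.toReal_div, ENNReal.toReal_ofReal h0, e3]
    simp only [ENNReal.toReal_mul, ENNReal.toReal_pow, ENNReal.toReal_natCast,
      ENNReal.toReal_ofNat]
    field_simp

/-- In a graph with large degrees in which all pairs of vertices have many common neighbours, the
average effective resistance is close to the average of the inverse degrees. -/
theorem averageResistance_sub_sum_inv_deg {G : SimpleGraph (Fin N)} {m κ q : ℝ} (hN : 0 < N)
    (hm : 0 < m) (hG : ∀ i j, i ≠ j → m ≤ codeg G i j) (hκ : m / (2 * N) ≤ κ) (hκ1 : κ ≤ 1)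
    (hq : 0 < q) (hdeg : ∀ i, N * q ≤ deg G i) :
    averageResistance G ≠ ⊤ ∧
      N * (averageResistance G).toReal - ∑ i, 1 / deg G i ≤ 2 / m * (1 / q + κ ^ 2 / q ^ 2) ∧
      ∑ i, 1 / deg G i - N * (averageResistance G).toReal ≤ κ / (N * q ^ 2) + 1 / (κ * N) := by
  have hN' : (0 : ℝ) < N := by exact_mod_cast hN
  have hκ0 : 0 < κ := lt_of_lt_of_le (by positivity) hκ
  have h := isCoercive_shiftedLap hN hm hG hκ
  obtain ⟨h1, h2⟩ := toReal_averageResistance hN hκ0 h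
  have hdiag : ∀ i, shiftedLap G κ i i = deg G i + κ := by intro i; simp [shiftedLap]
  have hd0 : ∀ i, 0 < deg G i := fun i => lt_of_lt_of_le (by positivity) (hdeg i)
  refine ⟨h1, ?_, ?_⟩
  · have key : ∀ i, (shiftedLap G κ)⁻¹ i i - 1 / deg G i ≤
        2 / m * (1 / q + κ ^ 2 / q ^ 2) / N := by
      intro i
      have h3 := h.inv_diag_le i
      -- An off-diagonal entry is κ minus a 0-1 number, with square at most adj + κ².
      have h4 : ∑ k ∈ Finset.univ.erase i, shiftedLap G κ k i ^ 2 ≤ deg G i + N * κ ^ 2 := by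
        have : ∑ k ∈ Finset.univ.erase i, shiftedLap G κ k i ^ 2 ≤
            ∑ k ∈ Finset.univ.erase i, (adj G i k + κ ^ 2) := by
          refine Finset.sum_le_sum fun k hk => ?_
          have hki : k ≠ i := Finset.ne_of_mem_erase hk
          simp only [shiftedLap, of_apply, if_neg hki, adj_symm G k i]
          nlinarith [adj_sq G i k, adj_nonneg G i k]
        refine this.trans ((Finset.sum_le_sum_of_subset_of_nonneg (Finset.erase_subset _ _)
          fun k _ _ => add_nonneg (adj_nonneg _ _ _) (sq_nonneg _)).trans ?_)
        simp [Finset.sum_add_distrib, deg]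
      rw [hdiag] at h3
      have hd := hd0 i
      have h5 : 1 / (deg G i + κ) ≤ 1 / deg G i :=
        one_div_le_one_div_of_le hd (by linarith)
      have h6 : (∑ k ∈ Finset.univ.erase i, shiftedLap G κ k i ^ 2) / (m / 2 * (deg G i + κ) ^ 2) ≤
          (deg G i + N * κ ^ 2) / (m / 2 * deg G i ^ 2) := by
        gcongr
        linarith
      have h7 : (deg G i + N * κ ^ 2) / (m / 2 * deg G i ^ 2) =
          2 / m * (1 / deg G i + N * κ ^ 2 / deg G i ^ 2) := by
        field_simp
      have h8 : 1 / deg G i ≤ 1 / (N * q) := one_div_le_one_div_of_le (by positivity) (hdeg i)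
      have h9 : N * κ ^ 2 / deg G i ^ 2 ≤ N * κ ^ 2 / (N * q) ^ 2 := by
        have := hdeg i
        gcongr
      have h10 : 2 / m * (1 / q + κ ^ 2 / q ^ 2) / N =
          2 / m * (1 / (N * q) + N * κ ^ 2 / (N * q) ^ 2) := by field_simp
      rw [h10]
      have h11 : 2 / m * (1 / deg G i + N * κ ^ 2 / deg G i ^ 2) ≤
          2 / m * (1 / (N * q) + N * κ ^ 2 / (N * q) ^ 2) :=
        mul_le_mul_of_nonneg_left (add_le_add h8 h9) (by positivity)
      linarith
    have h3 := Finset.sum_le_sum fun i (_ : i ∈ Finset.univ) => key i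
    rw [Finset.sum_sub_distrib] at h3
    have h4 : ∑ i : Fin N, 2 / m * (1 / q + κ ^ 2 / q ^ 2) / N =
        2 / m * (1 / q + κ ^ 2 / q ^ 2) := by
      rw [Finset.sum_const, Finset.card_univ, Fintype.card_fin, nsmul_eq_mul]
      field_simp
    have h5 : 0 ≤ 1 / (κ * N) := by positivity
    linarith
  · have key : ∀ i, 1 / deg G i - (shiftedLap G κ)⁻¹ i i ≤ κ / (N * q ^ 2) / N := by
      intro i
      have h3 := h.one_div_le_inv_diag i
      rw [hdiag] at h3
      have hd := hd0 i
      have h4 : 1 / deg G i - 1 / (deg G i + κ) ≤ κ / (N * q) ^ 2 := by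
        have e : 1 / deg G i - 1 / (deg G i + κ) = κ / (deg G i * (deg G i + κ)) := by
          field_simp; ring
        rw [e]
        have := hdeg i
        gcongr
        nlinarith [mul_pos hN' hq]
      have h5 : κ / (N * q ^ 2) / N = κ / (N * q) ^ 2 := by field_simp
      linarith
    have h3 := Finset.sum_le_sum fun i (_ : i ∈ Finset.univ) => key i
    rw [Finset.sum_sub_distrib] at h3
    have h4 : ∑ i : Fin N, κ / (N * q ^ 2) / N = κ / (N * q ^ 2) := by
      rw [Finset.sum_const, Finset.card_univ, Fintype.card_fin, nsmul_eq_mul]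
      field_simp
    linarith

end Graph

/-! ### Independent edges with given probabilities. -/

section EdgeProb

variable {N : ℕ}

/-- The pairs `(i, j)` with `i < j`, which index the possible edges. -/
def pairs (N : ℕ) : Finset (Fin N × Fin N) := Finset.univ.filter fun p => p.1 < p.2

theorem mem_pairs {p : Fin N × Fin N} : p ∈ pairs N ↔ p.1 < p.2 := by simp [pairs]

open Classical in
/-- The probability of the graph `H` when the edges are drawn independently with probabilities
`w i j`. -/
noncomputable def edgeProb (w : Fin N → Fin N → ℝ) (H : SimpleGraph (Fin N)) : ℝ :=
  ∏ p ∈ pairs N, if H.Adj p.1 p.2 then w p.1 p.2 else 1 - w p.1 p.2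

theorem edgeProb_nonneg {w : Fin N → Fin N → ℝ} (h0 : ∀ i j, 0 ≤ w i j) (h1 : ∀ i j, w i j ≤ 1)
    (H : SimpleGraph (Fin N)) : 0 ≤ edgeProb w H := by
  refine Finset.prod_nonneg fun p _ => ?_
  split_ifs
  · exact h0 _ _
  · linarith [h1 p.1 p.2]

-- A graph is its set of edges in `pairs N`, so the sum over graphs is the expansion of the product
-- over subsets.
open Classical in
theorem sum_graph_prod_ite (f g : Fin N × Fin N → ℝ) :
    ∑ H : SimpleGraph (Fin N), ∏ p ∈ pairs N, (if H.Adj p.1 p.2 then f p else g p) =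
      ∏ p ∈ pairs N, (f p + g p) := by
  rw [Finset.prod_add]
  refine Finset.sum_nbij' (fun H => (pairs N).filter fun p => H.Adj p.1 p.2)
    (fun t => SimpleGraph.fromRel fun a b => (a, b) ∈ t) ?_ ?_ ?_ ?_ ?_
  · intro H _
    simp
  · simp
  · intro H _
    ext a b
    simp only [SimpleGraph.fromRel_adj, Finset.mem_filter, mem_pairs]
    constructor
    · rintro ⟨-, h | h⟩
      · exact h.2
      · exact h.2.symm
    · intro h
      refine ⟨h.ne, ?_⟩
      rcases lt_or_gt_of_ne h.ne with hab | hab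
      · exact Or.inl ⟨hab, h⟩
      · exact Or.inr ⟨hab, h.symm⟩
  · intro t ht
    rw [Finset.mem_powerset] at ht
    ext p
    simp only [SimpleGraph.fromRel_adj, Finset.mem_filter, mem_pairs]
    constructor
    · rintro ⟨h1, -, h | h⟩
      · exact h
      · exact absurd (mem_pairs.1 (ht h)) (not_lt.2 h1.le)
    · intro h
      have := mem_pairs.1 (ht h)
      exact ⟨this, this.ne, Or.inl h⟩
  · intro H _
    rw [Finset.prod_ite, ← Finset.filter_not]

/-- The indicator is absorbed in the weights: a non-edge in F gets weight 0, so pairs in F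
contribute w and all others w + (1 - w) = 1. -/
theorem sum_edgeProb_mul_prod_adj (w : Fin N → Fin N → ℝ) {F : Finset (Fin N × Fin N)}
    (hF : F ⊆ pairs N) :
    ∑ H, edgeProb w H * ∏ p ∈ F, adj H p.1 p.2 = ∏ p ∈ F, w p.1 p.2 := by
  classical
  have h1 : ∀ H : SimpleGraph (Fin N), edgeProb w H * ∏ p ∈ F, adj H p.1 p.2 =
      ∏ p ∈ pairs N, (if H.Adj p.1 p.2 then w p.1 p.2 else
        if p ∈ F then 0 else 1 - w p.1 p.2) := by
    intro H
    have h2 : ∏ p ∈ F, adj H p.1 p.2 = ∏ p ∈ pairs N, if p ∈ F then adj H p.1 p.2 else 1 := by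
      rw [Finset.prod_ite_mem, Finset.inter_eq_right.2 hF]
    rw [h2, edgeProb, ← Finset.prod_mul_distrib]
    refine Finset.prod_congr rfl fun p _ => ?_
    by_cases hA : H.Adj p.1 p.2 <;> by_cases hp : p ∈ F <;> simp [adj, hA, hp]
  simp only [h1]
  rw [sum_graph_prod_ite (fun p => w p.1 p.2) (fun p => if p ∈ F then 0 else 1 - w p.1 p.2)]
  rw [← Finset.inter_eq_right.2 hF, ← Finset.prod_ite_mem]
  refine Finset.prod_congr rfl fun p hp => ?_
  by_cases hpF : p ∈ F <;> simp [hpF, hp]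

/-- Expectations of products over disjoint sets of edges factorize. -/
theorem sum_edgeProb_mul_prod {ι : Type*} (w : Fin N → Fin N → ℝ) (T : Finset ι) (c : ι → ℝ)
    (F : ι → Finset (Fin N × Fin N)) (hF : ∀ k ∈ T, F k ⊆ pairs N)
    (hd : (T : Set ι).PairwiseDisjoint F) :
    ∑ H, edgeProb w H * ∏ k ∈ T, (1 + c k * ∏ p ∈ F k, adj H p.1 p.2) =
      ∏ k ∈ T, (1 + c k * ∏ p ∈ F k, w p.1 p.2) := by
  classical
  simp only [Finset.prod_one_add, Finset.mul_sum]
  rw [Finset.sum_comm]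
  refine Finset.sum_congr rfl fun t ht => ?_
  rw [Finset.mem_powerset] at ht
  have hdt : (t : Set ι).PairwiseDisjoint F := hd.subset (by exact_mod_cast ht)
  simp only [Finset.prod_mul_distrib, ← Finset.prod_biUnion hdt, mul_left_comm (edgeProb w _)]
  rw [← Finset.mul_sum, sum_edgeProb_mul_prod_adj]
  exact Finset.biUnion_subset.2 fun k hk => hF k (ht hk)

theorem apply_min_max {w : Fin N → Fin N → ℝ} (hw : ∀ i j, w i j = w j i) (a b : Fin N) :
    w (min a b) (max a b) = w a b := by
  rcases le_total a b with h | h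
  · rw [min_eq_left h, max_eq_right h]
  · rw [min_eq_right h, max_eq_left h, hw]

theorem min_max_mem_pairs {a b : Fin N} (h : a ≠ b) : (min a b, max a b) ∈ pairs N :=
  mem_pairs.2 (min_lt_max.2 h)

theorem min_max_injective {a b c d : Fin N} (h : (min a b, max a b) = (min c d, max c d)) :
    (a = c ∧ b = d) ∨ (a = d ∧ b = c) := by
  simp only [Prod.mk.injEq] at h
  obtain ⟨h1, h2⟩ := h
  rcases le_total a b with hab | hab <;> rcases le_total c d with hcd | hcd <;>
    simp only [hab, hcd, min_eq_left, min_eq_right, max_eq_left, max_eq_right] at h1 h2 <;>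
    simp [h1, h2]

/-- The exponential is affine on {0, 1}; this gives moment generating functions the product form of
`sum_edgeProb_mul_prod`. -/
theorem exp_mul_adj (G : SimpleGraph (Fin N)) (t : ℝ) (a b : Fin N) :
    Real.exp (t * adj G a b) = 1 + (Real.exp t - 1) * adj G a b := by
  unfold adj; split_ifs <;> simp

theorem sum_edgeProb_mul_exp_deg {w : Fin N → Fin N → ℝ} (hw : ∀ i j, w i j = w j i)
    (a : Fin N) (t : ℝ) :
    ∑ H, edgeProb w H * Real.exp (t * deg H a) =
      ∏ b ∈ Finset.univ.erase a, (1 + (Real.exp t - 1) * w a b) := by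
  have h1 := sum_edgeProb_mul_prod w (Finset.univ.erase a) (fun _ => Real.exp t - 1)
    (fun b => {(min a b, max a b)}) ?_ ?_
  · simp only [Finset.prod_singleton, apply_min_max hw, apply_min_max (adj_symm _)] at h1
    rw [← h1]
    refine Finset.sum_congr rfl fun H _ => ?_
    rw [deg, Finset.mul_sum, Real.exp_sum, ← Finset.mul_prod_erase _ _ (Finset.mem_univ a)]
    simp [exp_mul_adj]
  · intro b hb
    rw [Finset.singleton_subset_iff]
    exact min_max_mem_pairs (Finset.ne_of_mem_erase hb).symm
  · intro b hb c hc hbc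
    rw [Function.onFun, Finset.disjoint_singleton]
    intro h
    rcases min_max_injective h with h | h
    · exact hbc h.2
    · exact Finset.ne_of_mem_erase hb h.2

/-- For distinct k outside {a, b} the edge sets {ak, bk} are disjoint, so the events that k is a
common neighbour are independent. The indices a and b contribute nothing, there being no loops. -/
theorem sum_edgeProb_mul_exp_neg_codeg {w : Fin N → Fin N → ℝ} (hw : ∀ i j, w i j = w j i)
    {a b : Fin N} (hab : a ≠ b) :
    ∑ H, edgeProb w H * Real.exp (-codeg H a b) =
      ∏ k ∈ (Finset.univ.erase a).erase b, (1 + (Real.exp (-1) - 1) * (w a k * w b k)) := by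
  have hne : ∀ k, (min a k, max a k) ≠ (min b k, max b k) := by
    intro k h
    rcases min_max_injective h with h | h
    · exact hab h.1
    · exact hab (h.1.trans h.2)
  have h1 := sum_edgeProb_mul_prod w ((Finset.univ.erase a).erase b) (fun _ => Real.exp (-1) - 1)
    (fun k => {(min a k, max a k), (min b k, max b k)}) ?_ ?_
  · simp only [Finset.prod_pair (hne _), apply_min_max hw, apply_min_max (adj_symm _)] at h1
    rw [← h1]
    refine Finset.sum_congr rfl fun H _ => ?_
    have hb : b ∈ Finset.univ.erase a := Finset.mem_erase.2 ⟨hab.symm, Finset.mem_univ b⟩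
    rw [codeg, ← Finset.sum_neg_distrib, Real.exp_sum,
      ← Finset.mul_prod_erase _ _ (Finset.mem_univ a), ← Finset.mul_prod_erase _ _ hb]
    have h2 : ∀ k, Real.exp (-(adj H a k * adj H b k)) =
        1 + (Real.exp (-1) - 1) * (adj H a k * adj H b k) := by
      intro k; unfold adj; split_ifs <;> simp
    simp [h2]
  · intro k hk
    simp only [Finset.mem_erase, Finset.mem_univ, and_true] at hk
    rw [Finset.insert_subset_iff, Finset.singleton_subset_iff]
    exact ⟨min_max_mem_pairs hk.2.symm, min_max_mem_pairs hk.1.symm⟩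
  · intro k hk l hl hkl
    simp only [Finset.coe_erase, Set.mem_sdiff, Set.mem_singleton_iff, Finset.coe_univ,
      Set.mem_univ, true_and] at hk hl
    rw [Function.onFun, Finset.disjoint_left]
    intro p hp hp'
    simp only [Finset.mem_insert, Finset.mem_singleton] at hp hp'
    rcases hp with rfl | rfl <;> rcases hp' with h | h <;>
      rcases min_max_injective h with h | h <;> simp_all

theorem sum_edgeProb_mul_exp_neg_codeg_le {w : Fin N → Fin N → ℝ} (hw : ∀ i j, w i j = w j i)
    {η : ℝ} (h0 : 0 ≤ η) (hη : ∀ i j, η ≤ w i j) (h1 : ∀ i j, w i j ≤ 1) {a b : Fin N}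
    (hab : a ≠ b) :
    ∑ H, edgeProb w H * Real.exp (-codeg H a b) ≤
      Real.exp (-((N - 2) * ((1 - Real.exp (-1)) * η ^ 2))) := by
  rw [sum_edgeProb_mul_exp_neg_codeg hw hab]
  have he : Real.exp (-1) ≤ 1 := Real.exp_le_one_iff.2 (by norm_num)
  have he0 := Real.exp_pos (-1)
  have hcard : (((Finset.univ.erase a).erase b).card : ℝ) = N - 2 := by
    have hb : b ∈ Finset.univ.erase a := Finset.mem_erase.2 ⟨hab.symm, Finset.mem_univ b⟩
    have c1 := Finset.card_erase_add_one hb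
    have c2 := Finset.card_erase_add_one (Finset.mem_univ a)
    rw [Finset.card_univ, Fintype.card_fin] at c2
    have : ((Finset.univ.erase a).erase b).card + 2 = N := by omega
    have h2 : (((Finset.univ.erase a).erase b).card : ℝ) + 2 = N := by exact_mod_cast this
    linarith
  calc ∏ k ∈ (Finset.univ.erase a).erase b, (1 + (Real.exp (-1) - 1) * (w a k * w b k))
      ≤ ∏ k ∈ (Finset.univ.erase a).erase b, Real.exp (-((1 - Real.exp (-1)) * η ^ 2)) := by
        refine Finset.prod_le_prod (fun k _ => ?_) fun k _ => ?_
        · have : w a k * w b k ≤ 1 := mul_le_one₀ (h1 a k) (h0.trans (hη b k)) (h1 b k)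
          nlinarith [mul_nonneg (h0.trans (hη a k)) (h0.trans (hη b k))]
        · have h2 : η ^ 2 ≤ w a k * w b k := by
            rw [sq]; exact mul_le_mul (hη a k) (hη b k) h0 (h0.trans (hη a k))
          have h3 := Real.add_one_le_exp (-((1 - Real.exp (-1)) * η ^ 2))
          nlinarith
    _ = Real.exp (-((N - 2) * ((1 - Real.exp (-1)) * η ^ 2))) := by
        rw [Finset.prod_const, ← Real.exp_nat_mul, hcard]
        congr 1; ring

end EdgeProb

/-! ### Removing the order statistics: the law of the renumbered graph. -/

section Law

open MeasureTheory ProbabilityTheory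
open scoped unitInterval ENNReal

variable {N : ℕ}

theorem measurableSet_sort_eq (ρ : Equiv.Perm (Fin N)) :
    MeasurableSet {x : Fin N → I | Tuple.sort x = ρ} := by
  have h : {x : Fin N → I | Tuple.sort x = ρ} =
      (⋂ i, ⋂ j, {x | i ≤ j → x (ρ i) ≤ x (ρ j)}) ∩
        ⋂ i, ⋂ j, {x | i < j → x (ρ i) = x (ρ j) → ρ i < ρ j} := by
    ext x
    simp only [Set.mem_ofPred_eq, Set.mem_inter_iff, Set.mem_iInter]
    rw [eq_comm, Tuple.eq_sort_iff]
    rfl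
  rw [h]
  refine MeasurableSet.inter ?_ ?_
  · refine MeasurableSet.iInter fun i => MeasurableSet.iInter fun j => ?_
    by_cases hij : i ≤ j
    · simpa [hij] using measurableSet_le (measurable_pi_apply (ρ i)) (measurable_pi_apply (ρ j))
    · simp [hij]
  · refine MeasurableSet.iInter fun i => MeasurableSet.iInter fun j => ?_
    by_cases hij : i < j
    · by_cases hs : ρ i < ρ j
      · simp [hs]
      · have hc : {x : Fin N → I | i < j → x (ρ i) = x (ρ j) → ρ i < ρ j} =
            {x | x (ρ i) = x (ρ j)}ᶜ := by
          ext x; simp [hij, hs]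
        rw [hc]
        exact (measurableSet_eq_fun (measurable_pi_apply (ρ i)) (measurable_pi_apply (ρ j))).compl
    · simp [hij]

/-- The graph `G`, whose vertices are numbered by the order statistics of `x`, with the vertices
renumbered in the order of the points `x i` themselves. -/
noncomputable def relabel (x : Fin N → I) (G : SimpleGraph (Fin N)) : SimpleGraph (Fin N) :=
  G.comap (Tuple.sort x).symm

theorem relabel_eq_iff (x : Fin N → I) (G H : SimpleGraph (Fin N)) :
    relabel x G = H ↔ G = H.comap (Tuple.sort x) := by
  constructor
  · rintro rfl
    ext a b
    simp [relabel]
  · rintro rfl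
    ext a b
    simp [relabel]

theorem adj_relabel (x : Fin N → I) (G : SimpleGraph (Fin N)) (i j : Fin N) :
    adj (relabel x G) (Tuple.sort x i) (Tuple.sort x j) = adj G i j := by
  have h : (relabel x G).Adj (Tuple.sort x i) (Tuple.sort x j) ↔ G.Adj i j := by simp [relabel]
  by_cases h' : G.Adj i j
  · simp [adj, h.2 h', h']
  · simp [adj, mt h.1 h', h']

theorem deg_relabel (x : Fin N → I) (G : SimpleGraph (Fin N)) (i : Fin N) :
    deg (relabel x G) (Tuple.sort x i) = deg G i := by
  unfold deg
  rw [← Equiv.sum_comp (Tuple.sort x)]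
  simp only [adj_relabel]

theorem codeg_relabel (x : Fin N → I) (G : SimpleGraph (Fin N)) (i j : Fin N) :
    codeg (relabel x G) (Tuple.sort x i) (Tuple.sort x j) = codeg G i j := by
  unfold codeg
  rw [← Equiv.sum_comp (Tuple.sort x)]
  simp only [adj_relabel]

/-- A permutation may reverse the order within a pair; symmetry of g makes this harmless. -/
theorem prod_pairs_perm (g : Fin N → Fin N → ℝ) (hg : ∀ i j, g i j = g j i)
    (ρ : Equiv.Perm (Fin N)) :
    ∏ p ∈ pairs N, g (ρ p.1) (ρ p.2) = ∏ p ∈ pairs N, g p.1 p.2 := by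
  have hmm : ∀ p ∈ pairs N, (min p.1 p.2, max p.1 p.2) = p := by
    intro p hp
    have := (mem_pairs.1 hp).le
    rw [min_eq_left this, max_eq_right this]
  have key : ∀ (τ : Equiv.Perm (Fin N)), ∀ p ∈ pairs N,
      (min (τ.symm (min (τ p.1) (τ p.2))) (τ.symm (max (τ p.1) (τ p.2))),
        max (τ.symm (min (τ p.1) (τ p.2))) (τ.symm (max (τ p.1) (τ p.2)))) = p := by
    intro τ p hp
    rcases le_total (τ p.1) (τ p.2) with h | h
    · rw [min_eq_left h, max_eq_right h, Equiv.symm_apply_apply, Equiv.symm_apply_apply, hmm p hp]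
    · rw [min_eq_right h, max_eq_left h, Equiv.symm_apply_apply, Equiv.symm_apply_apply, min_comm,
        max_comm, hmm p hp]
  refine Finset.prod_nbij' (fun p => (min (ρ p.1) (ρ p.2), max (ρ p.1) (ρ p.2)))
    (fun p => (min (ρ.symm p.1) (ρ.symm p.2), max (ρ.symm p.1) (ρ.symm p.2))) ?_ ?_ ?_ ?_ ?_
  · exact fun p hp => min_max_mem_pairs (ρ.injective.ne (mem_pairs.1 hp).ne)
  · exact fun p hp => min_max_mem_pairs (ρ.symm.injective.ne (mem_pairs.1 hp).ne)
  · exact fun p hp => key ρ p hp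
  · exact fun p hp => key ρ.symm p hp
  · exact fun p hp => (apply_min_max hg _ _).symm

/-- Renumbering only permutes the factors, and in the original order the edge probabilities depend
on the x i without sorting. -/
theorem graphProb_comap {W : I → I → ℝ} (hW : IsGraphon W) (x : Fin N → I)
    (H : SimpleGraph (Fin N)) :
    graphProb W x (H.comap (Tuple.sort x)) = edgeProb (fun i j => W (x i) (x j)) H := by
  classical
  rw [edgeProb, ← prod_pairs_perm (fun i j => if H.Adj i j then W (x i) (x j) else
    1 - W (x i) (x j)) (fun i j => ?_) (Tuple.sort x)]
  · rfl
  · simp only [H.adj_comm i j, hW.symm (x i) (x j)]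

theorem measurable_edgeProb {W : I → I → ℝ} (hW : IsGraphon W) (H : SimpleGraph (Fin N)) :
    Measurable fun x : Fin N → I => edgeProb (fun i j => W (x i) (x j)) H := by
  refine Finset.measurable_prod _ fun p _ => ?_
  have hp : Measurable fun x : Fin N → I => Function.uncurry W (x p.1, x p.2) :=
    hW.measurable.comp ((measurable_pi_apply p.1).prodMk (measurable_pi_apply p.2))
  split_ifs
  · exact hp
  · exact measurable_const.sub hp

variable {W : I → I → ℝ} {Ω : Type*} [MeasurableSpace Ω] {P : Measure Ω}
  {X : Fin N → Ω → I} {G : Ω → SimpleGraph (Fin N)}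

namespace IsSampledGraph

theorem measurable_pi (hG : IsSampledGraph W N P X G) : Measurable fun ω i => X i ω :=
  measurable_pi_lambda _ hG.measurable_latent

variable [IsProbabilityMeasure P]

theorem map_eq_volume (hG : IsSampledGraph W N P X G) :
    P.map (fun ω i => X i ω) = (volume : Measure (Fin N → I)) := by
  rw [(iIndepFun_iff_map_fun_eq_pi_map fun i => (hG.measurable_latent i).aemeasurable).1
    hG.indep_latent]
  simp only [hG.uniform_latent]
  rfl

/-- Split by the sorting permutation ρ: where it is fixed, the renumbered graph is H exactly when G
is `H.comap ρ`, and the given conditional law applies. The latent points are then integrated against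
product measure. -/
theorem law_relabel (hG : IsSampledGraph W N P X G) (hW : IsGraphon W) (H : SimpleGraph (Fin N))
    {B : Set (Fin N → I)} (hB : MeasurableSet B) :
    P ({ω | (fun i => X i ω) ∈ B} ∩ {ω | relabel (fun i => X i ω) (G ω) = H}) =
      ∫⁻ x in B, ENNReal.ofReal (edgeProb (fun i j => W (x i) (x j)) H) := by
  set Y : Ω → Fin N → I := fun ω i => X i ω with hY
  have hYm : Measurable Y := hG.measurable_pi
  have hC : ∀ ρ, MeasurableSet (B ∩ {x : Fin N → I | Tuple.sort x = ρ}) :=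
    fun ρ => hB.inter (measurableSet_sort_eq ρ)
  have h1 : {ω | Y ω ∈ B} ∩ {ω | relabel (Y ω) (G ω) = H} =
      ⋃ ρ : Equiv.Perm (Fin N), ({ω | Y ω ∈ B ∩ {x | Tuple.sort x = ρ}} ∩
        {ω | G ω = H.comap ρ}) := by
    ext ω
    simp only [Set.mem_inter_iff, Set.mem_ofPred_eq, Set.mem_iUnion, relabel_eq_iff]
    constructor
    · rintro ⟨h1, h2⟩
      exact ⟨_, ⟨h1, rfl⟩, h2⟩
    · rintro ⟨ρ, ⟨h1, rfl⟩, h2⟩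
      exact ⟨h1, h2⟩
  have hdisj : Pairwise (Function.onFun Disjoint fun ρ : Equiv.Perm (Fin N) =>
      Y ⁻¹' (B ∩ {x | Tuple.sort x = ρ})) := by
    intro ρ τ hρτ
    refine Set.disjoint_left.2 fun ω h h' => hρτ (h.2.symm.trans h'.2)
  have hpre : Y ⁻¹' B = ⋃ ρ : Equiv.Perm (Fin N), Y ⁻¹' (B ∩ {x | Tuple.sort x = ρ}) := by
    ext ω; simp
  rw [h1, measure_iUnion, ← hG.map_eq_volume, setLIntegral_map hB
    (f := fun x : Fin N → I => ENNReal.ofReal (edgeProb (fun i j => W (x i) (x j)) H))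
    (ENNReal.measurable_ofReal.comp (measurable_edgeProb hW H)) hYm, hpre,
    lintegral_iUnion (fun ρ => hYm (hC ρ)) hdisj]
  · refine tsum_congr fun ρ => ?_
    rw [hG.law_given_latent (H.comap ρ) _ (hC ρ)]
    refine setLIntegral_congr_fun (hYm (hC ρ)) fun ω hω => ?_
    obtain ⟨-, rfl⟩ := hω
    simp only [graphProb_comap hW, hY]
  · exact fun ρ τ hρτ => (hdisj hρτ).mono Set.inter_subset_left Set.inter_subset_left
  · exact fun ρ => (hYm (hC ρ)).inter (hG.measurable_graph _)

/-- Markov's inequality for statistics of the renumbered graph and the latent points. -/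
theorem measure_one_le_le (hG : IsSampledGraph W N P X G) (hW : IsGraphon W)
    {f : (Fin N → I) → SimpleGraph (Fin N) → ℝ} (hf : ∀ H, Measurable fun x => f x H)
    (hf0 : ∀ x H, 0 ≤ f x H) :
    P {ω | 1 ≤ f (fun i => X i ω) (relabel (fun i => X i ω) (G ω))} ≤
      ∫⁻ x : Fin N → I, ENNReal.ofReal (∑ H, edgeProb (fun i j => W (x i) (x j)) H * f x H) := by
  have hB : ∀ H, MeasurableSet {x | 1 ≤ f x H} := fun H => measurableSet_le measurable_const (hf H)
  have hnn : ∀ (x : Fin N → I) H, 0 ≤ edgeProb (fun i j => W (x i) (x j)) H := fun x H =>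
    edgeProb_nonneg (fun i j => hW.nonneg _ _) (fun i j => hW.le_one _ _) H
  calc P {ω | 1 ≤ f (fun i => X i ω) (relabel (fun i => X i ω) (G ω))}
      ≤ P (⋃ H, ({ω | (fun i => X i ω) ∈ {x | 1 ≤ f x H}} ∩
          {ω | relabel (fun i => X i ω) (G ω) = H})) := by
        refine measure_mono fun ω hω => ?_
        exact Set.mem_iUnion.2 ⟨_, hω, rfl⟩
    _ ≤ ∑ H, P ({ω | (fun i => X i ω) ∈ {x | 1 ≤ f x H}} ∩
          {ω | relabel (fun i => X i ω) (G ω) = H}) := measure_iUnion_fintype_le _ _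
    _ ≤ ∑ H, ∫⁻ x : Fin N → I,
          ENNReal.ofReal (edgeProb (fun i j => W (x i) (x j)) H * f x H) := by
        refine Finset.sum_le_sum fun H _ => ?_
        rw [hG.law_relabel hW H (hB H)]
        refine (setLIntegral_mono' (hB H) fun x hx => ?_).trans (setLIntegral_le_lintegral _ _)
        exact ENNReal.ofReal_le_ofReal (le_mul_of_one_le_right (hnn x H) hx)
    _ = _ := by
        rw [← lintegral_finsetSum]
        · refine lintegral_congr fun x => ?_
          rw [ENNReal.ofReal_sum_of_nonneg fun H _ => mul_nonneg (hnn x H) (hf0 x H)]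
        · exact fun H _ => ENNReal.measurable_ofReal.comp ((measurable_edgeProb hW H).mul (hf H))

end IsSampledGraph

end Law

/-! ### Bounds on degree function and operator norm; Hoeffding's lemma. -/

section Basic

open MeasureTheory ProbabilityTheory
open scoped unitInterval ENNReal

variable {W : I → I → ℝ}

namespace IsGraphon

theorem eta_le (hW : IsGraphon W) (x y : I) : eta W ≤ W x y :=
  ciInf_le (f := fun p : I × I => W p.1 p.2)
    ⟨0, by rintro _ ⟨p, rfl⟩; exact hW.nonneg p.1 p.2⟩ (x, y)

theorem eta_le_one (hW : IsGraphon W) : eta W ≤ 1 := (hW.eta_le 0 0).trans (hW.le_one 0 0)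

theorem measurable_right (hW : IsGraphon W) (x : I) : Measurable (W x) :=
  hW.measurable.comp measurable_prodMk_left

theorem integrable_right (hW : IsGraphon W) (x : I) : Integrable (W x) :=
  Integrable.of_mem_Icc 0 1 (hW.measurable_right x).aemeasurable
    (Filter.Eventually.of_forall fun y => ⟨hW.nonneg x y, hW.le_one x y⟩)

theorem measurable_degree (hW : IsGraphon W) : Measurable (degree W) :=
  (hW.measurable.stronglyMeasurable.integral_prod_right (f := W)).measurable

theorem degree_le_one (hW : IsGraphon W) (x : I) : degree W x ≤ 1 := by
  have := integral_mono (hW.integrable_right x) (integrable_const 1) fun y => hW.le_one x y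
  simpa [degree] using this

theorem eta_le_degree (hW : IsGraphon W) (x : I) : eta W ≤ degree W x := by
  have := integral_mono (integrable_const (eta W)) (hW.integrable_right x) fun y => hW.eta_le x y
  simpa [degree] using this

theorem eta_le_minDegree (hW : IsGraphon W) : eta W ≤ minDegree W :=
  le_ciInf fun x => hW.eta_le_degree x

theorem minDegree_le (hW : IsGraphon W) (hη : 0 < eta W) (x : I) : minDegree W ≤ degree W x :=
  ciInf_le ⟨0, by rintro _ ⟨y, rfl⟩; exact hη.le.trans (hW.eta_le_degree y)⟩ x

/-- Test with the constant 1, whose image is the degree function. Boundedness must be proved too,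
since a real `sSup` of an unbounded set is 0. -/
theorem eta_le_opNorm (hW : IsGraphon W) (hη : 0 < eta W) : eta W ≤ opNorm W := by
  have hbound : ∀ f : I → ℝ, eLpNorm f 2 volume = 1 → MemLp f 2 volume → ∀ x,
      |integralOp W f x| ≤ 1 := by
    intro f hf hfm x
    have h1 : Integrable f := hfm.integrable (by norm_num)
    have h2 : |integralOp W f x| ≤ ∫ y, |f y| := by
      refine (abs_integral_le_integral_abs).trans ?_
      refine integral_mono_of_nonneg (Filter.Eventually.of_forall fun y => abs_nonneg _) h1.abs
        (Filter.Eventually.of_forall fun y => ?_)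
      simp only [abs_mul, abs_of_nonneg (hW.nonneg x y)]
      exact mul_le_of_le_one_left (abs_nonneg _) (hW.le_one x y)
    have h3 : ∫ y, |f y| = (eLpNorm f 1 volume).toReal := by
      rw [eLpNorm_one_eq_lintegral_enorm, ← integral_norm_eq_lintegral_enorm h1.1]
      rfl
    have h4 : eLpNorm f 1 volume ≤ eLpNorm f 2 volume :=
      eLpNorm_le_eLpNorm_of_exponent_le (by norm_num) h1.1
    rw [hf] at h4
    have h5 := ENNReal.toReal_mono ENNReal.one_ne_top h4
    rw [ENNReal.toReal_one] at h5
    linarith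
  have hbdd : BddAbove {r : ℝ | ∃ f : I → ℝ, MemLp f 2 volume ∧ eLpNorm f 2 volume = 1 ∧
      r = (eLpNorm (integralOp W f) 2 volume).toReal} := by
    refine ⟨1, ?_⟩
    rintro r ⟨f, hfm, hf, rfl⟩
    have h1 : eLpNorm (integralOp W f) 2 volume ≤ 1 := by
      refine (eLpNorm_le_of_ae_bound (C := 1) (Filter.Eventually.of_forall fun x => ?_)).trans ?_
      · exact hbound f hf hfm x
      · simp
    simpa using ENNReal.toReal_mono ENNReal.one_ne_top h1
  refine le_trans ?_ (le_csSup hbdd ⟨fun _ => 1, memLp_const 1, ?_, rfl⟩)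
  · have h1 : integralOp W (fun _ => 1) = degree W := by
      ext x; simp [integralOp, degree]
    rw [h1]
    have h2 : eLpNorm (fun _ : I => eta W) 2 volume ≤ eLpNorm (degree W) 2 volume := by
      refine eLpNorm_mono_real fun x => ?_
      rw [Real.norm_of_nonneg hη.le]
      exact hW.eta_le_degree x
    have h3 : eLpNorm (degree W) 2 volume ≠ ⊤ := by
      refine (lt_of_le_of_lt (eLpNorm_le_of_ae_bound (C := 1)
        (Filter.Eventually.of_forall fun x => ?_)) ?_).ne
      · rw [Real.norm_of_nonneg (hη.le.trans (hW.eta_le_degree x))]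
        exact hW.degree_le_one x
      · simp
    have h4 := ENNReal.toReal_mono h3 h2
    rw [eLpNorm_const _ (by norm_num) (NeZero.ne _)] at h4
    simpa [Real.enorm_eq_ofReal hη.le, ENNReal.toReal_ofReal hη.le, abs_of_pos hη] using h4
  · rw [eLpNorm_const _ (by norm_num) (NeZero.ne _)]
    simp

end IsGraphon

/-- Hoeffding's bound for the moment generating function of a Bernoulli variable. -/
theorem one_add_exp_sub_one_mul_le {p : ℝ} (h0 : 0 ≤ p) (h1 : p ≤ 1) (t : ℝ) :
    1 + (Real.exp t - 1) * p ≤ Real.exp (t * p + t ^ 2 / 8) := by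
  -- The Bernoulli law itself, to which the sub-Gaussian bound for variables in [0,1] applies.
  set μ : Measure ℝ := ENNReal.ofReal p • Measure.dirac 1 + ENNReal.ofReal (1 - p) • Measure.dirac 0
    with hμ
  have hprob : IsProbabilityMeasure μ := by
    constructor
    simp only [hμ, Measure.coe_add, Measure.coe_smul, Pi.add_apply, Pi.smul_apply, smul_eq_mul,
      measure_univ, mul_one]
    rw [← ENNReal.ofReal_add h0 (by linarith)]
    simp
  have hint : ∀ g : ℝ → ℝ, ∫ y, g y ∂μ = p * g 1 + (1 - p) * g 0 := by
    intro g
    have hd : ∀ (c a : ℝ), Integrable g (ENNReal.ofReal c • Measure.dirac a) := fun c a =>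
      (integrable_dirac (by simp)).smul_measure ENNReal.ofReal_ne_top
    rw [hμ, integral_add_measure (hd _ _) (hd _ _), integral_smul_measure, integral_smul_measure,
      integral_dirac, integral_dirac, ENNReal.toReal_ofReal h0,
      ENNReal.toReal_ofReal (by linarith), smul_eq_mul, smul_eq_mul]
  have hae : ∀ᵐ y ∂μ, id y ∈ Set.Icc (0 : ℝ) 1 := by
    rw [hμ, ae_add_measure_iff]
    constructor
    · exact Measure.ae_smul_measure (by rw [ae_dirac_eq]; simp) _
    · exact Measure.ae_smul_measure (by rw [ae_dirac_eq]; simp) _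
  have h2 := (hasSubgaussianMGF_of_mem_Icc (μ := μ) measurable_id.aemeasurable hae).mgf_le t
  rw [mgf, hint, hint] at h2
  have h3 : (((‖(1 : ℝ) - 0‖₊ / 2) ^ 2 : NNReal) : ℝ) * t ^ 2 / 2 = t ^ 2 / 8 := by
    push_cast; simp; ring
  rw [h3] at h2
  simp only [id, mul_one, mul_zero, add_zero] at h2
  rw [Real.exp_add]
  have h4 := mul_le_mul_of_nonneg_left h2 (Real.exp_pos (t * p)).le
  refine le_trans (le_of_eq ?_) h4
  rw [mul_add, mul_left_comm, mul_left_comm (Real.exp (t * p)), ← Real.exp_add, ← Real.exp_add]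
  ring_nf
  simp
  ring

end Basic

/-! ### Tail bounds for the three exceptional events. -/

section Tail

open MeasureTheory ProbabilityTheory
open scoped unitInterval ENNReal

variable {W : I → I → ℝ}

theorem prod_univ_erase_succAbove {n : ℕ} (a : Fin (n + 1)) (g : Fin (n + 1) → ℝ) :
    ∏ b ∈ Finset.univ.erase a, g b = ∏ j : Fin n, g (a.succAbove j) := by
  have h : Finset.univ.erase a = Finset.univ.image a.succAbove := by
    rw [Fin.image_succAbove_univ]; ext b; simp
  rw [h, Finset.prod_image fun i _ j _ hij => Fin.succAbove_right_injective hij]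

/-- The integrated moment generating function of a degree, given the latent points. -/
theorem lintegral_mgf_degree_le (hW : IsGraphon W) {n : ℕ} (a : Fin (n + 1)) (t v : ℝ) :
    ∫⁻ x : Fin (n + 1) → I, ENNReal.ofReal (Real.exp (-(t * (n * degree W (x a))) - v) *
      ∏ b ∈ Finset.univ.erase a, (1 + (Real.exp t - 1) * W (x a) (x b))) ≤
        ENNReal.ofReal (Real.exp (n * t ^ 2 / 8 - v)) := by
  -- Separate the coordinate x a. Once it is fixed, the other n coordinates are independent and each
  -- factor integrates to the moment generating function of a Bernoulli variable of mean d(x a).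
  set F : I × (Fin n → I) → ℝ≥0∞ := fun z =>
    ENNReal.ofReal (Real.exp (-(t * (n * degree W z.1)) - v) *
      ∏ j, (1 + (Real.exp t - 1) * Function.uncurry W (z.1, z.2 j))) with hF
  have hFm : Measurable F := by
    refine ENNReal.measurable_ofReal.comp (Measurable.mul ?_ ?_)
    · exact Real.measurable_exp.comp ((((hW.measurable_degree.comp measurable_fst).const_mul
        (n : ℝ)).const_mul t).neg.sub_const v)
    · refine Finset.measurable_prod _ fun j _ => measurable_const.add (Measurable.const_mul ?_ _)
      exact hW.measurable.comp
        (measurable_fst.prodMk ((measurable_pi_apply j).comp measurable_snd))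
  have h1 : ∀ x : Fin (n + 1) → I, ENNReal.ofReal (Real.exp (-(t * (n * degree W (x a))) - v) *
      ∏ b ∈ Finset.univ.erase a, (1 + (Real.exp t - 1) * W (x a) (x b))) =
      F (MeasurableEquiv.piFinSuccAbove (fun _ => I) a x) := by
    intro x
    rw [hF, prod_univ_erase_succAbove]
    rfl
  simp only [h1]
  rw [(volume_preserving_piFinSuccAbove (fun _ : Fin (n + 1) => I) a).lintegral_comp hFm]
  rw [show (volume : Measure (I × (Fin n → I))) = volume.prod volume from rfl,
    lintegral_prod _ hFm.aemeasurable]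
  have hexp : -1 ≤ Real.exp t - 1 := by linarith [Real.exp_pos t]
  have hnn : ∀ x y, 0 ≤ 1 + (Real.exp t - 1) * W x y := fun x y => by
    nlinarith [hW.nonneg x y, hW.le_one x y]
  have h2 : ∀ x : I, ∫⁻ y : Fin n → I, F (x, y) ≤
      ENNReal.ofReal (Real.exp (n * t ^ 2 / 8 - v)) := by
    intro x
    have hint : Integrable (fun y : I => 1 + (Real.exp t - 1) * W x y) :=
      (integrable_const 1).add ((hW.integrable_right x).const_mul _)
    have hint' : Integrable (fun y : Fin n → I => Real.exp (-(t * (n * degree W x)) - v) *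
        ∏ j, (1 + (Real.exp t - 1) * W x (y j))) :=
      (Integrable.fintype_prod fun _ => hint).const_mul _
    have h3 : ∫ y : I, (1 + (Real.exp t - 1) * W x y) = 1 + (Real.exp t - 1) * degree W x := by
      rw [integral_add (integrable_const 1) ((hW.integrable_right x).const_mul _),
        integral_const_mul]
      simp [degree]
    have hd0 : 0 ≤ degree W x := integral_nonneg fun y => hW.nonneg x y
    simp only [hF, Function.uncurry_apply_pair]
    rw [← ofReal_integral_eq_lintegral_ofReal hint' (Filter.Eventually.of_forall fun y =>
      mul_nonneg (Real.exp_pos _).le (Finset.prod_nonneg fun j _ => hnn _ _))]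
    refine ENNReal.ofReal_le_ofReal ?_
    rw [integral_const_mul, integral_fintype_prod_volume_eq_prod
      (f := fun (_ : Fin n) (y : I) => 1 + (Real.exp t - 1) * W x y), h3, Finset.prod_const,
      Finset.card_univ, Fintype.card_fin]
    have h4 := one_add_exp_sub_one_mul_le hd0 (hW.degree_le_one x) t
    have h5 : 0 ≤ 1 + (Real.exp t - 1) * degree W x := by
      nlinarith [hW.degree_le_one x]
    calc Real.exp (-(t * (n * degree W x)) - v) * (1 + (Real.exp t - 1) * degree W x) ^ n
        ≤ Real.exp (-(t * (n * degree W x)) - v) *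
            (Real.exp (t * degree W x + t ^ 2 / 8)) ^ n := by gcongr
      _ = Real.exp (n * t ^ 2 / 8 - v) := by
        rw [← Real.exp_nat_mul, ← Real.exp_add]
        congr 1; ring
  refine (lintegral_mono h2).trans ?_
  simp

variable {Ω : Type*} [MeasurableSpace Ω] {P : Measure Ω} [IsProbabilityMeasure P]

namespace IsSampledGraph

theorem measure_degree_mgf {n : ℕ} {X : Fin (n + 1) → Ω → I} {G : Ω → SimpleGraph (Fin (n + 1))}
    (hG : IsSampledGraph W (n + 1) P X G) (hW : IsGraphon W) (a : Fin (n + 1)) (t v : ℝ) :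
    P {ω | v ≤ t * (deg (relabel (fun i => X i ω) (G ω)) a - n * degree W (X a ω))} ≤
      ENNReal.ofReal (Real.exp (n * t ^ 2 / 8 - v)) := by
  have h1 := hG.measure_one_le_le hW
    (f := fun x H => Real.exp (t * (deg H a - n * degree W (x a)) - v)) (fun H => ?_)
    (fun x H => (Real.exp_pos _).le)
  · refine le_trans (measure_mono fun ω hω => ?_) (h1.trans (le_trans (le_of_eq ?_)
      (lintegral_mgf_degree_le hW a t v)))
    · exact Real.one_le_exp (sub_nonneg.2 hω)
    · refine lintegral_congr fun x => ?_
      rw [← sum_edgeProb_mul_exp_deg (w := fun i j => W (x i) (x j)) (fun i j => hW.symm _ _),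
        Finset.mul_sum]
      congr 1
      refine Finset.sum_congr rfl fun H _ => ?_
      rw [mul_left_comm, ← Real.exp_add]
      congr 2; ring
  · refine Real.measurable_exp.comp (Measurable.sub_const (Measurable.const_mul
      (measurable_const.sub (Measurable.const_mul ?_ _)) _) _)
    exact hW.measurable_degree.comp (measurable_pi_apply a)

/-- Hoeffding's bound for the deviation of the degrees from the degree function. -/
theorem measure_exists_degree_deviation {n : ℕ} (hn : 0 < n) {X : Fin (n + 1) → Ω → I}
    {G : Ω → SimpleGraph (Fin (n + 1))} (hG : IsSampledGraph W (n + 1) P X G) (hW : IsGraphon W)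
    {u : ℝ} (hu : 0 < u) :
    P {ω | ∃ a, u ≤ |deg (relabel (fun i => X i ω) (G ω)) a - n * degree W (X a ω)|} ≤
      ENNReal.ofReal (2 * (n + 1) * Real.exp (-(2 * u ^ 2 / n))) := by
  have hn' : (0 : ℝ) < n := by exact_mod_cast hn
  have key : ∀ (a : Fin (n + 1)) (ε : ℝ), ε ^ 2 = 1 →
      P {ω | u ≤ ε * (deg (relabel (fun i => X i ω) (G ω)) a - n * degree W (X a ω))} ≤
        ENNReal.ofReal (Real.exp (-(2 * u ^ 2 / n))) := by
    intro a ε hε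
    -- The value t = 4u/n minimizes n t²/8 - t u; the sign ε selects the tail.
    refine le_trans (measure_mono fun ω hω => ?_) ((hG.measure_degree_mgf hW a (4 * u / n * ε)
      (4 * u / n * u)).trans (le_of_eq ?_))
    · rw [Set.mem_ofPred_eq] at hω ⊢
      rw [mul_assoc]
      exact mul_le_mul_of_nonneg_left hω (by positivity)
    · congr 2
      rw [mul_pow, hε]
      field_simp
      ring
  have hsub : {ω | ∃ a, u ≤ |deg (relabel (fun i => X i ω) (G ω)) a - n * degree W (X a ω)|} ⊆
      ⋃ a, ({ω | u ≤ 1 * (deg (relabel (fun i => X i ω) (G ω)) a - n * degree W (X a ω))} ∪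
        {ω | u ≤ (-1) * (deg (relabel (fun i => X i ω) (G ω)) a - n * degree W (X a ω))}) := by
    rintro ω ⟨a, ha⟩
    refine Set.mem_iUnion.2 ⟨a, ?_⟩
    rcases le_abs.1 ha with h | h
    · exact Or.inl (by simpa using h)
    · exact Or.inr (by simpa using h)
  refine (measure_mono hsub).trans ((measure_iUnion_fintype_le _ _).trans ?_)
  refine (Finset.sum_le_sum fun a _ => (measure_union_le _ _).trans
    (add_le_add (key a 1 (by norm_num)) (key a (-1) (by norm_num)))).trans (le_of_eq ?_)
  rw [Finset.sum_const, Finset.card_univ, Fintype.card_fin, ← ENNReal.ofReal_add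
    (Real.exp_pos _).le (Real.exp_pos _).le, ← ENNReal.ofReal_nsmul]
  congr 1
  rw [nsmul_eq_mul]; push_cast; ring

/-- A Chernoff bound for the numbers of common neighbours. -/
theorem measure_exists_codeg_lt {N : ℕ} {X : Fin N → Ω → I}
    {G : Ω → SimpleGraph (Fin N)} (hG : IsSampledGraph W N P X G) (hW : IsGraphon W)
    (hη : 0 ≤ eta W) (m : ℝ) :
    P {ω | ∃ a b, a ≠ b ∧ codeg (relabel (fun i => X i ω) (G ω)) a b < m} ≤
      ENNReal.ofReal (N ^ 2 * Real.exp (m - (N - 2) * ((1 - Real.exp (-1)) * eta W ^ 2))) := by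
  have key : ∀ p : Fin N × Fin N,
      P {ω | p.1 ≠ p.2 ∧ codeg (relabel (fun i => X i ω) (G ω)) p.1 p.2 < m} ≤
        ENNReal.ofReal (Real.exp (m - (N - 2) * ((1 - Real.exp (-1)) * eta W ^ 2))) := by
    intro p
    by_cases hp : p.1 = p.2
    · simp [hp]
    have h1 := hG.measure_one_le_le hW (f := fun _ H => Real.exp (m - codeg H p.1 p.2))
      (fun H => measurable_const) (fun x H => (Real.exp_pos _).le)
    refine le_trans (measure_mono fun ω hω => ?_) (h1.trans
      ((lintegral_mono (g := fun _ => ENNReal.ofReal (Real.exp (m - (N - 2) *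
        ((1 - Real.exp (-1)) * eta W ^ 2)))) fun x => ?_).trans (by simp)))
    · exact Real.one_le_exp (sub_nonneg.2 hω.2.le)
    · refine ENNReal.ofReal_le_ofReal ?_
      have h2 := sum_edgeProb_mul_exp_neg_codeg_le (w := fun i j => W (x i) (x j))
        (fun i j => hW.symm _ _) hη (fun i j => hW.eta_le _ _) (fun i j => hW.le_one _ _) hp
      have h3 := mul_le_mul_of_nonneg_left h2 (Real.exp_pos m).le
      rw [← Real.exp_add, Finset.mul_sum] at h3
      refine le_trans (le_of_eq ?_) (h3.trans (le_of_eq (by ring_nf)))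
      refine Finset.sum_congr rfl fun H _ => ?_
      rw [mul_left_comm, ← Real.exp_add]
      rfl
  have hsub : {ω | ∃ a b, a ≠ b ∧ codeg (relabel (fun i => X i ω) (G ω)) a b < m} ⊆
      ⋃ p : Fin N × Fin N,
        {ω | p.1 ≠ p.2 ∧ codeg (relabel (fun i => X i ω) (G ω)) p.1 p.2 < m} := by
    rintro ω ⟨a, b, h⟩
    exact Set.mem_iUnion.2 ⟨(a, b), h⟩
  refine (measure_mono hsub).trans ((measure_iUnion_fintype_le _ _).trans ?_)
  refine (Finset.sum_le_sum fun p _ => key p).trans (le_of_eq ?_)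
  rw [Finset.sum_const, Finset.card_univ, Fintype.card_prod, Fintype.card_fin,
    ← ENNReal.ofReal_nsmul]
  congr 1
  rw [nsmul_eq_mul]; push_cast; ring

/-- Hoeffding's inequality for the average of the inverse degree function at the latent points. -/
theorem measureReal_inv_degree_deviation {N : ℕ} (hN : 0 < N) {X : Fin N → Ω → I}
    {G : Ω → SimpleGraph (Fin N)} (hG : IsSampledGraph W N P X G) (hW : IsGraphon W)
    (hη : 0 < eta W) {u : ℝ} (hu : 0 ≤ u) :
    P.real {ω | N * (u / minDegree W) ≤
      |∑ i, 1 / degree W (X i ω) - N * ∫ x : I, 1 / degree W x|} ≤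
        2 * Real.exp (-(2 * N * u ^ 2)) := by
  have hN' : (0 : ℝ) < N := by exact_mod_cast hN
  have hδ : 0 < minDegree W := hη.trans_le hW.eta_le_minDegree
  have hfm : Measurable fun x : I => 1 / degree W x := measurable_const.div hW.measurable_degree
  have hIcc : ∀ x : I, 1 / degree W x ∈ Set.Icc 0 (1 / minDegree W) := fun x =>
    ⟨by have := hη.trans_le (hW.eta_le_degree x); positivity,
      one_div_le_one_div_of_le hδ (hW.minDegree_le hη x)⟩
  have hmean : ∀ i, ∫ ω, 1 / degree W (X i ω) ∂P = ∫ x : I, 1 / degree W x := by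
    intro i
    rw [← hG.uniform_latent i, integral_map (hG.measurable_latent i).aemeasurable
      hfm.aestronglyMeasurable]
  have hsubG : ∀ i, HasSubgaussianMGF
      (fun ω => 1 / degree W (X i ω) - ∫ x : I, 1 / degree W x)
      ((‖1 / minDegree W - 0‖₊ / 2) ^ 2) P := by
    intro i
    have := hasSubgaussianMGF_of_mem_Icc (μ := P) (X := fun ω => 1 / degree W (X i ω))
      (hfm.comp (hG.measurable_latent i)).aemeasurable
      (Filter.Eventually.of_forall fun ω => hIcc (X i ω))
    rwa [hmean i] at this
  have hind : iIndepFun (fun i ω => 1 / degree W (X i ω) - ∫ x : I, 1 / degree W x) P :=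
    hG.indep_latent.comp (fun _ x => 1 / degree W x - ∫ x : I, 1 / degree W x)
      fun _ => hfm.sub_const _
  have hind' : iIndepFun (fun i ω => -(1 / degree W (X i ω) - ∫ x : I, 1 / degree W x)) P :=
    hG.indep_latent.comp (fun _ x => -(1 / degree W x - ∫ x : I, 1 / degree W x))
      fun _ => (hfm.sub_const _).neg
  have hε : 0 ≤ N * (u / minDegree W) := by positivity
  have hexp : -(N * (u / minDegree W)) ^ 2 /
      (2 * ((∑ i ∈ (Finset.univ : Finset (Fin N)), (‖1 / minDegree W - 0‖₊ / 2) ^ 2 : NNReal) : ℝ))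
        = -(2 * N * u ^ 2) := by
    push_cast
    rw [Finset.sum_const, Finset.card_univ, Fintype.card_fin, nsmul_eq_mul, sub_zero,
      Real.norm_of_nonneg (by positivity)]
    field_simp
  have t1 := HasSubgaussianMGF.measure_sum_ge_le_of_iIndepFun hind
    (s := Finset.univ) (fun i _ => hsubG i) hε
  have t2 := HasSubgaussianMGF.measure_sum_ge_le_of_iIndepFun hind'
    (s := Finset.univ) (fun i _ => (hsubG i).neg) hε
  rw [hexp] at t1 t2
  have hsub : {ω | N * (u / minDegree W) ≤
      |∑ i, 1 / degree W (X i ω) - N * ∫ x : I, 1 / degree W x|} ⊆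
      {ω | N * (u / minDegree W) ≤ ∑ i, (1 / degree W (X i ω) - ∫ x : I, 1 / degree W x)} ∪
      {ω | N * (u / minDegree W) ≤ ∑ i, -(1 / degree W (X i ω) - ∫ x : I, 1 / degree W x)} := by
    intro ω hω
    have e : ∑ i, (1 / degree W (X i ω) - ∫ x : I, 1 / degree W x) =
        ∑ i, 1 / degree W (X i ω) - N * ∫ x : I, 1 / degree W x := by
      simp [Finset.sum_sub_distrib]
    rw [Set.mem_ofPred_eq] at hω
    rcases le_abs.1 hω with h | h
    · exact Or.inl (by rw [Set.mem_ofPred_eq, e]; exact h)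
    · exact Or.inr (by rw [Set.mem_ofPred_eq, Finset.sum_neg_distrib, e]; exact h)
  refine (measureReal_mono hsub).trans ((measureReal_union_le _ _).trans ?_)
  linarith

end IsSampledGraph

end Tail

/-! ### Numerical consequences of the sample size condition. -/

section Numerics

/-- Consequences of the assumption `φ(N) < η_W`. -/
theorem sample_size_bounds {N : ℕ} {ν η : ℝ} (hN : 0 < N) (hν : 0 < ν) (hν1 : ν < Real.exp (-1))
    (hη : 0 < η) (hη1 : η ≤ 1)
    (h : (1 / √η + 2) * √(Real.log (2 * N / ν) / N) < η) :
    5 < Real.log (2 * N / ν) ∧ 47 ≤ N ∧ 9 * Real.log (2 * N / ν) < N * η ^ 2 ∧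
      3 * √(Real.log (2 * N / ν) / N) ≤ η := by
  have hN' : (0 : ℝ) < N := by exact_mod_cast hN
  have hN1 : (1 : ℝ) ≤ N := by exact_mod_cast hN
  set Λ := Real.log (2 * N / ν) with hΛ
  have hΛlog : 1 + Real.log (2 * N) < Λ := by
    have h1 : Real.log ν < -1 := by
      rw [Real.log_lt_iff_lt_exp hν]; exact hν1
    rw [hΛ, Real.log_div (by positivity) hν.ne']
    linarith
  have hΛ1 : 1 < Λ := by
    have : 0 ≤ Real.log (2 * N) := Real.log_nonneg (by linarith)
    linarith
  set s := √(Λ / N) with hs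
  have hs2 : s ^ 2 = Λ / N := Real.sq_sqrt (by positivity)
  have hs0 : 0 ≤ s := Real.sqrt_nonneg _
  have hr0 : 0 < √η := Real.sqrt_pos.2 hη
  have hr1 : √η ≤ 1 := Real.sqrt_le_one.2 hη1
  have hr2 : √η ^ 2 = η := Real.sq_sqrt hη.le
  set r := √η
  -- The hypothesis cleared of denominators, with r = √η. Since r ≤ 1, it gives 3rs < r³, that is,
  -- 3s < η.
  have h1 : (1 + 2 * r) * s < r ^ 3 := by
    have : (1 + 2 * r) * s = r * ((1 / r + 2) * s) := by field_simp
    rw [this, pow_succ' r 2, hr2]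
    exact mul_lt_mul_of_pos_left h hr0
  have h2 : 3 * s < η := by
    have h3 : r * (3 * s) ≤ (1 + 2 * r) * s := by nlinarith
    have h4 : r * (3 * s) < r * η := by rw [← hr2]; nlinarith
    exact lt_of_mul_lt_mul_left h4 hr0.le
  have h3 : 9 * Λ < N * η ^ 2 := by
    have h4 : (3 * s) ^ 2 < η ^ 2 := by
      have : 0 ≤ 3 * s := by positivity
      nlinarith
    rw [mul_pow, hs2] at h4
    have h5 := mul_lt_mul_of_pos_left h4 hN'
    have h6 : (N : ℝ) * (3 ^ 2 * (Λ / N)) = 9 * Λ := by field_simp; norm_num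
    linarith
  have h4 : 9 * Λ < N := by
    have : (N : ℝ) * η ^ 2 ≤ N := by
      have : η ^ 2 ≤ 1 := pow_le_one₀ hη.le hη1
      nlinarith
    linarith
  have hl2 := Real.log_two_gt_d9
  -- Bootstrap between Λ > 1 + log(2N) and N > 9Λ: successively 2N ≥ 16, 2N ≥ 64, Λ > 5 and N > 46.
  have h5 : (16 : ℝ) ≤ 2 * N := by linarith
  have h6 : 4 * Real.log 2 ≤ Real.log (2 * N) := by
    have := Real.log_le_log (by norm_num) h5
    rwa [show (16 : ℝ) = 2 ^ (4 : ℕ) by norm_num, Real.log_pow] at this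
  have h7 : (64 : ℝ) ≤ 2 * N := by linarith
  have h8 : 6 * Real.log 2 ≤ Real.log (2 * N) := by
    have := Real.log_le_log (by norm_num) h7
    rwa [show (64 : ℝ) = 2 ^ (6 : ℕ) by norm_num, Real.log_pow] at this
  refine ⟨by linarith, ?_, h3, h2.le⟩
  have h9 : (46 : ℝ) < N := by linarith
  exact_mod_cast h9

/-- The deviation Ns - 1 leaves room for replacing (N - 1)d by N d. As (Ns)² = NΛ and Ns ≥ 10, the
exponent still exceeds Λ, and exp(-Λ) = ν/(2N) cancels the union bound. -/
theorem two_mul_mul_exp_le {N : ℕ} {ν s : ℝ} (hN : 47 ≤ N) (hν : 0 < ν)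
    (hΛ : 5 < Real.log (2 * N / ν)) (hs0 : 0 ≤ s) (hs : s ^ 2 = Real.log (2 * N / ν) / N) :
    0 < N * s - 1 ∧
      2 * N * Real.exp (-(2 * (N * s - 1) ^ 2 / ((N : ℝ) - 1))) ≤ ν := by
  have hN' : (47 : ℝ) ≤ N := by exact_mod_cast hN
  have hN0 : (0 : ℝ) < N := by linarith
  set Λ := Real.log (2 * N / ν) with hΛd
  have hy : (N * s) ^ 2 = N * Λ := by rw [mul_pow, hs]; field_simp
  have hy0 : 0 ≤ N * s := by positivity
  have hy10 : 10 ≤ N * s := by nlinarith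
  refine ⟨by linarith, ?_⟩
  have h1 : Λ ≤ 2 * (N * s - 1) ^ 2 / ((N : ℝ) - 1) := by
    rw [le_div_iff₀ (by linarith)]
    nlinarith
  have h2 : Real.exp (-(2 * (N * s - 1) ^ 2 / ((N : ℝ) - 1))) ≤ Real.exp (-Λ) :=
    Real.exp_le_exp.2 (neg_le_neg h1)
  have h3 : Real.exp (-Λ) = ν / (2 * N) := by
    rw [Real.exp_neg, hΛd, Real.exp_log (by positivity), inv_div]
  rw [h3] at h2
  calc 2 * N * Real.exp (-(2 * (N * s - 1) ^ 2 / ((N : ℝ) - 1)))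
      ≤ 2 * N * (ν / (2 * N)) := by gcongr
    _ = ν := by field_simp

/-- The threshold 1/3 leaves the exponent (N - 2)η²(2/3 - 1/e). With (N - 2)η² ≥ 8Λ this is at least
2Λ, and exp(-2Λ) beats the union over N² pairs. -/
theorem sq_mul_exp_le {N : ℕ} {ν η : ℝ} (hN : 47 ≤ N) (hν : 0 < ν) (hν1 : ν ≤ 1)
    (hΛ : 5 < Real.log (2 * N / ν)) (h : 9 * Real.log (2 * N / ν) < N * η ^ 2) :
    N ^ 2 * Real.exp ((N - 2) * η ^ 2 / 3 - (N - 2) * ((1 - Real.exp (-1)) * η ^ 2)) ≤ ν := by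
  have hN' : (47 : ℝ) ≤ N := by exact_mod_cast hN
  have hN0 : (0 : ℝ) < N := by linarith
  set Λ := Real.log (2 * N / ν) with hΛd
  have he := Real.exp_neg_one_lt_d9
  have h1 : 8 * Λ ≤ (N - 2) * η ^ 2 := by
    have : 45 / 47 * (N * η ^ 2) ≤ (N - 2) * η ^ 2 := by
      rw [← mul_assoc]
      exact mul_le_mul_of_nonneg_right (by linarith) (sq_nonneg η)
    linarith
  have h2 : (N - 2) * η ^ 2 / 3 - (N - 2) * ((1 - Real.exp (-1)) * η ^ 2) ≤ -(2 * Λ) := by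
    have e : (N - 2) * η ^ 2 / 3 - (N - 2) * ((1 - Real.exp (-1)) * η ^ 2) =
      -(((N - 2) * η ^ 2) * (2 / 3 - Real.exp (-1))) := by ring
    rw [e]
    nlinarith
  have h3 : Real.exp (-(2 * Λ)) = (ν / (2 * N)) ^ 2 := by
    rw [show -(2 * Λ) = ((2 : ℕ) : ℝ) * (-Λ) by push_cast; ring, Real.exp_nat_mul, Real.exp_neg,
      hΛd, Real.exp_log (by positivity), inv_div]
  calc (N : ℝ) ^ 2 * Real.exp ((N - 2) * η ^ 2 / 3 - (N - 2) * ((1 - Real.exp (-1)) * η ^ 2))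
      ≤ N ^ 2 * (ν / (2 * N)) ^ 2 := by
        rw [← h3]; gcongr
    _ = ν * ν / 4 := by field_simp; norm_num
    _ ≤ ν := by nlinarith

theorem two_mul_exp_le {N : ℕ} {ν s : ℝ} (hN : 47 ≤ N) (hν : 0 < ν)
    (hΛ : 5 < Real.log (2 * N / ν)) (hs : s ^ 2 = Real.log (2 * N / ν) / N) :
    2 * Real.exp (-(2 * N * s ^ 2)) ≤ ν := by
  have hN' : (47 : ℝ) ≤ N := by exact_mod_cast hN
  have hN0 : (0 : ℝ) < N := by linarith
  set Λ := Real.log (2 * N / ν) with hΛd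
  have h1 : -(2 * N * s ^ 2) ≤ -Λ := by
    rw [hs]
    have : 2 * N * (Λ / N) = 2 * Λ := by field_simp
    linarith
  have h3 : Real.exp (-Λ) = ν / (2 * N) := by
    rw [Real.exp_neg, hΛd, Real.exp_log (by positivity), inv_div]
  calc 2 * Real.exp (-(2 * N * s ^ 2)) ≤ 2 * (ν / (2 * N)) := by
        rw [← h3]; gcongr
    _ = ν / N := by field_simp
    _ ≤ ν := div_le_self hν.le (by linarith)

/-- The spectral contribution to the error is dominated by the last term of the error bound. -/
theorem spectral_error_le {N : ℕ} {η T : ℝ} (hN : 47 ≤ N) (hη : 0 < η)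
    (h : 45 < N * η ^ 2) (hT : η ≤ T) {d e : ℝ} (hd : 0 < d) (hd1 : d ≤ η) (he : 0 < e)
    (he1 : e ≤ η) :
    13 / (N * η ^ 3) ≤ 1 / d * ((2 : ℝ) ^ (1 / 4 : ℝ) * √T / ((N : ℝ) ^ (1 / 4 : ℝ) * e)) := by
  have hN' : (47 : ℝ) ≤ N := by exact_mod_cast hN
  have hN0 : (0 : ℝ) < N := by linarith
  set y := (N : ℝ) ^ (1 / 4 : ℝ) with hy
  have hy0 : 0 < y := Real.rpow_pos_of_pos hN0 _
  have hy4 : y ^ 4 = N := by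
    rw [hy, ← Real.rpow_natCast, ← Real.rpow_mul hN0.le]; norm_num
  have hr0 : 0 < √η := Real.sqrt_pos.2 hη
  have hr2 : √η ^ 2 = η := Real.sq_sqrt hη.le
  have hrT : √η ≤ √T := Real.sqrt_le_sqrt hT
  set r := √η
  have h2 : (1 : ℝ) ≤ (2 : ℝ) ^ (1 / 4 : ℝ) := Real.one_le_rpow (by norm_num) (by norm_num)
  -- With r = √η and y = N^(1/4), the target has size at least 1/(r³y), and 13/(Nη³) = 13/(r⁶y⁴); so
  -- (ry)³ ≥ 13 is what is needed, and 2.4³ > 13 while 2.4⁴ < 45.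
  have hz4 : 45 < (r * y) ^ 4 := by
    rw [mul_pow, hy4, show r ^ 4 = (r ^ 2) ^ 2 by ring, hr2]; linarith
  have hz0 : 0 < r * y := by positivity
  have hz : 2.4 ≤ r * y := by
    by_contra hlt
    push Not at hlt
    have : (r * y) ^ 4 ≤ 2.4 ^ 4 := by gcongr
    norm_num at this
    linarith
  have hz3 : 13 ≤ (r * y) ^ 3 := by
    have : (2.4 : ℝ) ^ 3 ≤ (r * y) ^ 3 := by gcongr
    norm_num at this
    linarith
  calc 13 / (N * η ^ 3) ≤ (r * y) ^ 3 / (N * η ^ 3) := by gcongr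
    _ = 1 / η * (1 * r / (y * η)) := by
        rw [← hy4, ← hr2]; field_simp
    _ ≤ 1 / d * ((2 : ℝ) ^ (1 / 4 : ℝ) * √T / (y * e)) := by gcongr

end Numerics

/-! ### Assembly of the error bound. -/

section Approximation

open MeasureTheory ProbabilityTheory
open scoped unitInterval ENNReal

variable {W : I → I → ℝ} {N : ℕ} {ν : ℝ}

/-- The deterministic part of the approximation: regularity of the degrees and of the numbers of
common neighbours controls the average effective resistance. -/
theorem abs_averageResistance_sub_le (hW : IsGraphon W) (hη : 0 < eta W) (K : ℕ) (L : ℝ)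
    (hN : 47 ≤ N) (hν : 0 < ν) (hν1 : ν < Real.exp (-1)) (hφ : varphi W N ν < eta W)
    (x : Fin N → I) (G : SimpleGraph (Fin N))
    (hdeg : ∀ a, |deg (relabel x G) a - N * degree W (x a)| ≤ N * √(Real.log (2 * N / ν) / N))
    (hcodeg : ∀ a b, a ≠ b → (N - 2) * eta W ^ 2 / 3 ≤ codeg (relabel x G) a b)
    (hinv : |∑ a, 1 / degree W (x a) - N * ∫ t : I, 1 / degree W t| ≤
      N * (√(Real.log (2 * N / ν) / N) / minDegree W)) :
    averageResistance G ≠ ⊤ ∧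
      |(averageResistance G).toReal - graphonResistance W N| ≤ errorBound W K L N ν := by
  have hN' : (47 : ℝ) ≤ N := by exact_mod_cast hN
  have hN0 : (0 : ℝ) < N := by linarith
  have hNpos : 0 < N := by omega
  have hη1 := hW.eta_le_one
  have hδ : 0 < minDegree W := hη.trans_le hW.eta_le_minDegree
  obtain ⟨hΛ, -, hNη, hsη⟩ := sample_size_bounds hNpos hν hν1 hη hη1 hφ
  have hγs : gamma W N ν = √(Real.log (2 * N / ν) / N) / √(eta W) := by
    rw [gamma, ← div_div, Real.sqrt_div' _ hη.le]
  have hvar : varphi W N ν = (1 / √(eta W) + 2) * √(Real.log (2 * N / ν) / N) := rfl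
  have hphi : 2 * √(Real.log (2 * N / ν) / N) ≤ phi K L N ν := by
    have h1 : √(4 * Real.log (2 * N / ν) / N) = 2 * √(Real.log (2 * N / ν) / N) := by
      rw [mul_div_assoc, Real.sqrt_mul (by norm_num), show (4 : ℝ) = 2 ^ 2 by norm_num,
        Real.sqrt_sq (by norm_num)]
    rw [phi, h1, vartheta]
    have := Real.sqrt_nonneg ((L ^ 2 - (K : ℝ) ^ 2) * bN N ν ^ 2 + K * bN N ν)
    linarith
  have hs0 : 0 ≤ √(Real.log (2 * N / ν) / N) := Real.sqrt_nonneg _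
  set s := √(Real.log (2 * N / ν) / N) with hs
  set η := eta W with hηd
  set δ := minDegree W with hδd
  have hr0 : 0 < √η := Real.sqrt_pos.2 hη
  have hr1 : √η ≤ 1 := Real.sqrt_le_one.2 hη1
  have hsγ : s ≤ gamma W N ν := by
    rw [hγs]; exact le_div_self hs0 hr0 hr1
  have hγφ : gamma W N ν ≤ varphi W N ν := by
    rw [hγs, hvar, add_mul, one_div, div_eq_inv_mul]; linarith
  set γ := gamma W N ν
  set φ := varphi W N ν
  have hηγ : 0 < η - γ := by linarith
  have hdeg' : ∀ a, N * (η - s) ≤ deg (relabel x G) a := by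
    intro a
    have h1 := (abs_le.1 (hdeg a)).1
    have h2 := mul_le_mul_of_nonneg_left (hW.eta_le_degree (x a)) hN0.le
    rw [← hηd] at h2
    linarith
  have hdegG : ∀ i, N * (2 * η / 3) ≤ deg G i := by
    intro i
    rw [← deg_relabel x G i]
    refine le_trans ?_ (hdeg' _)
    exact mul_le_mul_of_nonneg_left (by linarith) hN0.le
  have hcodegG : ∀ i j, i ≠ j → (N - 2) * η ^ 2 / 3 ≤ codeg G i j := by
    intro i j hij
    rw [← codeg_relabel x G i j]
    exact hcodeg _ _ ((Tuple.sort x).injective.ne hij)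
  have hm : 0 < (N - 2) * η ^ 2 / 3 := by
    have : (0 : ℝ) < N - 2 := by linarith
    positivity
  have hη2 : η ^ 2 ≤ η := by nlinarith
  -- The lower degree bound 2η/3 comes from s ≤ η/3. Any κ comparable to η would serve; with η/2
  -- both errors fit under 13/(Nη³).
  obtain ⟨hfin, hup, hlow⟩ := averageResistance_sub_sum_inv_deg (κ := η / 2) hNpos hm hcodegG
    (by
      rw [div_le_iff₀ (by positivity)]
      nlinarith)
    (by linarith) (by positivity) hdegG
  refine ⟨hfin, ?_⟩
  have hup' : 2 / ((N - 2) * η ^ 2 / 3) * (1 / (2 * η / 3) + (η / 2) ^ 2 / (2 * η / 3) ^ 2) ≤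
      13 / (N * η ^ 3) := by
    have h2 : (0 : ℝ) < N - 2 := by linarith
    have e1 : 2 / ((N - 2) * η ^ 2 / 3) * (1 / (2 * η / 3) + (η / 2) ^ 2 / (2 * η / 3) ^ 2) =
        (9 + 27 / 8 * η) / ((N - 2) * η ^ 3) := by
      field_simp; ring
    rw [e1, div_le_div_iff₀ (by positivity) (by positivity)]
    have h3 : (9 + 27 / 8 * η) * N ≤ 13 * (N - 2) := by nlinarith
    have h4 := mul_le_mul_of_nonneg_right h3 (pow_pos hη 3).le
    linarith
  have hlow' : η / 2 / (N * (2 * η / 3) ^ 2) + 1 / (η / 2 * N) ≤ 13 / (N * η ^ 3) := by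
    have e1 : η / 2 / (N * (2 * η / 3) ^ 2) + 1 / (η / 2 * N) = 25 / 8 * η ^ 2 / (N * η ^ 3) := by
      field_simp; norm_num
    rw [e1]
    gcongr
    nlinarith
  set S := ∑ i, 1 / deg G i with hS
  have hSrel : S = ∑ a, 1 / deg (relabel x G) a := by
    rw [hS, ← Equiv.sum_comp (Tuple.sort x) fun a => 1 / deg (relabel x G) a]
    simp only [deg_relabel]
  have hSd : |S - ∑ a, 1 / (N * degree W (x a))| ≤ s / ((η - γ) * δ) := by
    rw [hSrel, ← Finset.sum_sub_distrib]
    refine (Finset.abs_sum_le_sum_abs _ _).trans ?_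
    have key : ∀ a, |1 / deg (relabel x G) a - 1 / (N * degree W (x a))| ≤
        s / ((η - γ) * δ) / N := by
      intro a
      have hd : δ ≤ degree W (x a) := hW.minDegree_le hη (x a)
      have hd0 : 0 < degree W (x a) := hδ.trans_le hd
      have hD : N * (η - γ) ≤ deg (relabel x G) a :=
        (mul_le_mul_of_nonneg_left (by linarith) hN0.le).trans (hdeg' a)
      have hD0 : 0 < deg (relabel x G) a := lt_of_lt_of_le (by positivity) hD
      have e1 : 1 / deg (relabel x G) a - 1 / (N * degree W (x a)) =
          -(deg (relabel x G) a - N * degree W (x a)) /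
            (deg (relabel x G) a * (N * degree W (x a))) := by
        field_simp; ring
      rw [e1, abs_div, abs_neg, abs_of_pos (by positivity :
        0 < deg (relabel x G) a * (N * degree W (x a)))]
      calc |deg (relabel x G) a - N * degree W (x a)| /
            (deg (relabel x G) a * (N * degree W (x a)))
          ≤ N * s / (N * (η - γ) * (N * δ)) := by
            have := hdeg a
            gcongr
        _ = s / ((η - γ) * δ) / N := by field_simp
    refine (Finset.sum_le_sum fun a _ => key a).trans (le_of_eq ?_)
    rw [Finset.sum_const, Finset.card_univ, Fintype.card_fin, nsmul_eq_mul]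
    field_simp
  set J := ∫ t : I, 1 / degree W t with hJ
  have hSJ : |∑ a, 1 / (N * degree W (x a)) - J| ≤ s / ((η - γ) * δ) := by
    have e1 : ∑ a, 1 / (N * degree W (x a)) - J =
        (∑ a, 1 / degree W (x a) - N * J) / N := by
      rw [sub_div, Finset.sum_div, mul_div_cancel_left₀ _ hN0.ne']
      congr 1
      refine Finset.sum_congr rfl fun a _ => ?_
      rw [div_div, mul_comm]
    rw [e1, abs_div, abs_of_pos hN0, div_le_iff₀ hN0]
    refine hinv.trans ?_
    rw [mul_comm]
    refine mul_le_mul_of_nonneg_right ?_ hN0.le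
    refine div_le_div_of_nonneg_left hs0 (by positivity) ?_
    exact mul_le_of_le_one_left hδ.le (by linarith [Real.sqrt_nonneg η])
  have hspec := spectral_error_le (T := opNorm W + phi K L N ν) hN hη (by linarith)
    (by linarith [hW.eta_le_opNorm hη]) hηγ (by linarith)
    (sub_pos.2 hφ : 0 < η - φ) (by linarith)
  set R := (averageResistance G).toReal with hR
  have hmain : |N * R - J| ≤ 13 / (N * η ^ 3) + 2 * (s / ((η - γ) * δ)) := by
    rw [abs_le] at hSd hSJ ⊢
    constructor <;> linarith [hSd.1, hSd.2, hSJ.1, hSJ.2]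
  have hgr : R - graphonResistance W N = (N * R - J) / N := by
    rw [graphonResistance, ← hJ]; field_simp
  rw [hgr, abs_div, abs_of_pos hN0, div_le_iff₀ hN0]
  refine hmain.trans ?_
  have hfinal : errorBound W K L N ν * N = 1 / (η - γ) * (1 / N) +
      phi K L N ν / ((η - γ) * δ) + 1 / (η - γ) *
        ((2 : ℝ) ^ (1 / 4 : ℝ) * √(opNorm W + phi K L N ν) /
          ((N : ℝ) ^ (1 / 4 : ℝ) * (η - φ))) := by
    change 1 / (N * (η - γ)) * (1 / N + phi K L N ν / δ + (2 : ℝ) ^ (1 / 4 : ℝ) *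
      √(opNorm W + phi K L N ν) / ((N : ℝ) ^ (1 / 4 : ℝ) * (η - φ))) * N = _
    have e1 : 1 / (N * (η - γ)) * N = 1 / (η - γ) := by field_simp
    rw [mul_right_comm, e1, mul_add, mul_add]
    congr 2
    field_simp
  rw [hfinal]
  -- Here ϕ(N) ≥ 2s absorbs the degree error and the sampling error together; the 1/N term of the
  -- bound is left as slack.
  have h1 : 2 * (s / ((η - γ) * δ)) ≤ phi K L N ν / ((η - γ) * δ) := by
    rw [← mul_div_assoc]; gcongr
  have h2 : 0 ≤ 1 / (η - γ) * (1 / (N : ℝ)) := by positivity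
  linarith

variable {Ω : Type*} [MeasurableSpace Ω] {P : Measure Ω} [IsProbabilityMeasure P]

/-- With high probability the average effective resistance is within `errorBound` of the graphon
approximation. The three exceptional events concern the degrees, the numbers of common neighbours
(which bound the spectral gap of the Laplacian from below) and the average of `1 / d` at the latent
points. Of the quantity `ϕ(N)` only the term `√(4 log(2N/ν)/N)` is needed, so that `W` need not be
piecewise Lipschitz. -/
theorem IsSampledGraph.one_sub_le_measureReal {X : Fin N → Ω → I} {G : Ω → SimpleGraph (Fin N)}
    (hG : IsSampledGraph W N P X G) (hW : IsGraphon W) (hη : 0 < eta W) (K : ℕ) (L : ℝ)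
    (hN : 0 < N) (hν : 0 < ν) (hν1 : ν < Real.exp (-1)) (hφ : varphi W N ν < eta W) :
    1 - 3 * ν ≤ P.real {ω | averageResistance (G ω) ≠ ⊤ ∧
      |(averageResistance (G ω)).toReal - graphonResistance W N| ≤ errorBound W K L N ν} := by
  obtain ⟨hΛ, hN47, hNη, hsη⟩ := sample_size_bounds hN hν hν1 hη hW.eta_le_one hφ
  have hν1' : ν ≤ 1 := hν1.le.trans (Real.exp_le_one_iff.2 (by norm_num))
  have hN0 : (0 : ℝ) < N := by exact_mod_cast hN
  have hs0 : 0 ≤ √(Real.log (2 * N / ν) / N) := Real.sqrt_nonneg _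
  have hs2 : √(Real.log (2 * N / ν) / N) ^ 2 = Real.log (2 * N / ν) / N :=
    Real.sq_sqrt (div_nonneg (by linarith) hN0.le)
  set s := √(Real.log (2 * N / ν) / N) with hs
  set B₁ := {ω | ∃ a, N * s - 1 ≤
    |deg (relabel (fun i => X i ω) (G ω)) a - (N - 1) * degree W (X a ω)|} with hB₁
  set B₂ := {ω | ∃ a b, a ≠ b ∧
    codeg (relabel (fun i => X i ω) (G ω)) a b < (N - 2) * eta W ^ 2 / 3} with hB₂
  set B₃ := {ω | N * (s / minDegree W) ≤
    |∑ i, 1 / degree W (X i ω) - N * ∫ x : I, 1 / degree W x|} with hB₃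
  have p₁ : P.real B₁ ≤ ν := by
    obtain ⟨hu, hle⟩ := two_mul_mul_exp_le hN47 hν hΛ hs0 hs2
    obtain ⟨n, rfl⟩ : ∃ n, N = n + 1 := ⟨N - 1, by omega⟩
    have h1 := hG.measure_exists_degree_deviation (by omega) hW hu
    have e1 : (((n + 1 : ℕ) : ℝ) - 1) = n := by push_cast; ring
    rw [e1] at hle
    rw [hB₁, e1]
    refine ENNReal.toReal_le_of_le_ofReal hν.le (h1.trans (ENNReal.ofReal_le_ofReal ?_))
    refine le_trans (le_of_eq ?_) hle
    push_cast
    rfl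
  have p₂ : P.real B₂ ≤ ν := by
    have h1 := hG.measure_exists_codeg_lt hW hη.le ((N - 2) * eta W ^ 2 / 3)
    exact ENNReal.toReal_le_of_le_ofReal hν.le (h1.trans (ENNReal.ofReal_le_ofReal
      (sq_mul_exp_le hN47 hν hν1' hΛ hNη)))
  have p₃ : P.real B₃ ≤ ν :=
    (hG.measureReal_inv_degree_deviation hN hW hη hs0).trans (two_mul_exp_le hN47 hν hΛ hs2)
  set S := {ω | averageResistance (G ω) ≠ ⊤ ∧
      |(averageResistance (G ω)).toReal - graphonResistance W N| ≤ errorBound W K L N ν} with hS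
  have hcover : (Set.univ : Set Ω) ⊆ S ∪ (B₁ ∪ (B₂ ∪ B₃)) := by
    intro ω _
    by_cases h : ω ∈ B₁ ∪ (B₂ ∪ B₃)
    · exact Or.inr h
    refine Or.inl ?_
    simp only [Set.mem_union, not_or] at h
    obtain ⟨h₁, h₂, h₃⟩ := h
    simp only [hB₁, hB₂, hB₃, Set.mem_ofPred_eq, not_exists, not_le, not_and, not_lt] at h₁ h₂ h₃
    refine abs_averageResistance_sub_le hW hη K L hN47 hν hν1 hφ (fun i => X i ω) (G ω)
      (fun a => ?_) (fun a b hab => h₂ a b hab) h₃.le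
    have h1 := abs_lt.1 (h₁ a)
    have hd0 := hη.le.trans (hW.eta_le_degree (X a ω))
    have hd1 := hW.degree_le_one (X a ω)
    rw [abs_le]
    constructor <;> nlinarith [h1.1, h1.2]
  have h1 : P.real Set.univ ≤ P.real S + (P.real B₁ + (P.real B₂ + P.real B₃)) :=
    (measureReal_mono hcover).trans ((measureReal_union_le _ _).trans (add_le_add le_rfl
      ((measureReal_union_le _ _).trans (add_le_add le_rfl (measureReal_union_le _ _)))))
  rw [probReal_univ] at h1
  linarith

end Approximation

/-! ### Asymptotic order of the error bound. -/

section Rate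

open Filter Topology

theorem tendsto_log_div_rpow_quarter :
    Tendsto (fun N : ℕ => (Real.log N / N) ^ (1 / 4 : ℝ)) atTop (𝓝 0) := by
  have h1 : Tendsto (fun x : ℝ => Real.log x / x) atTop (𝓝 0) := by
    simpa using Real.isLittleO_log_id_atTop.tendsto_div_nhds_zero
  have h2 := h1.comp (tendsto_natCast_atTop_atTop (R := ℝ))
  have h3 := h2.rpow_const (p := 1 / 4) (Or.inr (by norm_num))
  simpa using h3

/-- The quantity `ϕ(N)` has order `(log N / N) ^ (1 / 4)`. -/
theorem phi_le (K : ℕ) (L : ℝ) {N : ℕ} {ν C w : ℝ} (hC : 0 < C) (hN0 : (0 : ℝ) < N)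
    (h₁ : Real.log (N / ν) ≤ C * Real.log N) (h₂ : Real.log (2 * N / ν) ≤ C * Real.log N)
    (hw0 : 0 < w) (hw1 : w ≤ 1) (hw4 : w ^ 4 = Real.log N / N) (hNw : 1 / (N : ℝ) ≤ w ^ 4) :
    phi K L N ν ≤
      (2 * √C + 2 * √(L ^ 2 * (1 + √(8 * C)) ^ 2 + K * (1 + √(8 * C)))) * w := by
  set c₁ : ℝ := 1 + √(8 * C) with hc₁
  have hc₁0 : 0 < c₁ := by positivity
  have hw2 : √(Real.log N / N) = w ^ 2 := by
    rw [← hw4, show w ^ 4 = (w ^ 2) ^ 2 by ring, Real.sqrt_sq (by positivity)]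
  have hw21 : w ^ 2 ≤ w := by nlinarith
  have hw42 : w ^ 4 ≤ w ^ 2 := pow_le_pow_of_le_one hw0.le hw1 (by norm_num)
  have hsq : √(Real.log (2 * N / ν) / N) ≤ √C * w ^ 2 := by
    rw [← hw2, ← Real.sqrt_mul hC.le]
    refine Real.sqrt_le_sqrt ?_
    rw [← mul_div_assoc]; gcongr
  have hb0 : 0 ≤ bN N ν := by unfold bN; positivity
  have hb : bN N ν ≤ c₁ * w ^ 2 := by
    have h3 : √(8 * Real.log (N / ν) / (N + 1)) ≤ √(8 * C) * w ^ 2 := by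
      rw [← hw2, ← Real.sqrt_mul (by positivity)]
      refine Real.sqrt_le_sqrt ?_
      calc 8 * Real.log (N / ν) / (N + 1) ≤ 8 * (C * Real.log N) / (N + 1) := by gcongr
        _ ≤ 8 * (C * Real.log N) / N := by gcongr; linarith
        _ = 8 * C * (Real.log N / N) := by ring
    rw [bN, hc₁, add_mul, one_mul]
    linarith
  have h3 : √(4 * Real.log (2 * N / ν) / N) ≤ 2 * √C * w := by
    rw [mul_div_assoc, Real.sqrt_mul (by norm_num), show (4 : ℝ) = 2 ^ 2 by norm_num,
      Real.sqrt_sq (by norm_num)]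
    nlinarith [Real.sqrt_nonneg C]
  -- This term sets the rate: b_N is of order w², so √(K b_N) is of order w. The negative -K² b_N²
  -- is dropped.
  have h4 : √((L ^ 2 - (K : ℝ) ^ 2) * bN N ν ^ 2 + K * bN N ν) ≤
      √(L ^ 2 * c₁ ^ 2 + K * c₁) * w := by
    have e1 : √(L ^ 2 * c₁ ^ 2 + K * c₁) * w = √((L ^ 2 * c₁ ^ 2 + K * c₁) * w ^ 2) := by
      rw [Real.sqrt_mul (by positivity), Real.sqrt_sq hw0.le]
    rw [e1]
    refine Real.sqrt_le_sqrt ?_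
    have h5 : bN N ν ^ 2 ≤ c₁ ^ 2 * w ^ 2 := by
      calc bN N ν ^ 2 ≤ (c₁ * w ^ 2) ^ 2 := by gcongr
        _ = c₁ ^ 2 * w ^ 4 := by ring
        _ ≤ c₁ ^ 2 * w ^ 2 := by gcongr
    have h6 : (K : ℝ) * bN N ν ≤ K * (c₁ * w ^ 2) := by gcongr
    have h7 := mul_le_mul_of_nonneg_left h5 (sq_nonneg L)
    have h8 : 0 ≤ (K : ℝ) ^ 2 * bN N ν ^ 2 := by positivity
    linarith
  rw [phi, vartheta]
  linarith

/-- The error bound has order `(log N / N ^ 5) ^ (1 / 4)` as soon as `log (2 N / ν)` is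
of order `log N`. -/
theorem errorBound_isBigO {W : unitInterval → unitInterval → ℝ} (hW : IsGraphon W)
    (hη : 0 < eta W) (K : ℕ) (L : ℝ) {ν : ℕ → ℝ} {C : ℝ} (hC : 0 < C)
    (hν₁ : ∀ᶠ N : ℕ in atTop, Real.log (N / ν N) ≤ C * Real.log N)
    (hν₂ : ∀ᶠ N : ℕ in atTop, Real.log (2 * N / ν N) ≤ C * Real.log N) :
    (fun N : ℕ => errorBound W K L N (ν N)) =O[atTop]
      (fun N : ℕ => (Real.log N / (N : ℝ) ^ 5) ^ (1 / 4 : ℝ)) := by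
  have hδ : 0 < minDegree W := hη.trans_le hW.eta_le_minDegree
  set η := eta W with hηd
  set δ := minDegree W with hδd
  set c₃ : ℝ := 2 * √C + 2 * √(L ^ 2 * (1 + √(8 * C)) ^ 2 + K * (1 + √(8 * C))) with hc₃
  set c₄ : ℝ := (1 / √η + 2) * √C with hc₄
  have hr0 : 0 < √η := Real.sqrt_pos.2 hη
  have hc₃0 : 0 ≤ c₃ := by positivity
  have hc₄0 : 0 < c₄ := by positivity
  have hw := tendsto_log_div_rpow_quarter
  -- The second bound forces γ ≤ φ ≤ η/2, keeping both denominators away from 0.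
  have hsmall : ∀ᶠ N : ℕ in atTop, (Real.log N / N) ^ (1 / 4 : ℝ) < min 1 (η / (2 * c₄)) :=
    hw.eventually_lt_const (by positivity)
  refine Asymptotics.IsBigO.of_bound
    (2 / η * (1 + c₃ / δ + (2 : ℝ) ^ (1 / 4 : ℝ) * √(opNorm W + c₃) * (2 / η))) ?_
  filter_upwards [hν₁, hν₂, hsmall, eventually_ge_atTop 3] with N h₁ h₂ hws hN3
  have hN : (3 : ℝ) ≤ N := by exact_mod_cast hN3
  have hN0 : (0 : ℝ) < N := by linarith
  have hlog : 1 ≤ Real.log N := by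
    rw [Real.le_log_iff_exp_le hN0]
    linarith [Real.exp_one_lt_d9]
  have hℓ0 : 0 < Real.log N / N := by positivity
  set w := (Real.log N / N) ^ (1 / 4 : ℝ) with hwd
  have hw0 : 0 < w := Real.rpow_pos_of_pos hℓ0 _
  have hw1 : w ≤ 1 := (hws.trans_le (min_le_left _ _)).le
  have hw4 : w ^ 4 = Real.log N / N := by
    rw [hwd, ← Real.rpow_natCast, ← Real.rpow_mul hℓ0.le]; norm_num
  have hw2 : √(Real.log N / N) = w ^ 2 := by
    rw [← hw4, show w ^ 4 = (w ^ 2) ^ 2 by ring, Real.sqrt_sq (by positivity)]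
  have hw21 : w ^ 2 ≤ w := by nlinarith
  have hNw : 1 / (N : ℝ) ≤ w ^ 4 := by
    rw [hw4]; gcongr
  have hrhs : (Real.log N / (N : ℝ) ^ 5) ^ (1 / 4 : ℝ) = 1 / N * w := by
    have e1 : Real.log N / (N : ℝ) ^ 5 = (1 / N * w) ^ 4 := by
      rw [mul_pow, hw4]; field_simp
    rw [e1, ← Real.rpow_natCast, ← Real.rpow_mul (by positivity)]
    norm_num
  have hsq : √(Real.log (2 * N / ν N) / N) ≤ √C * w ^ 2 := by
    rw [← hw2, ← Real.sqrt_mul hC.le]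
    refine Real.sqrt_le_sqrt ?_
    rw [← mul_div_assoc]; gcongr
  have hphi0 : 0 ≤ phi K L N (ν N) := by unfold phi vartheta; positivity
  have hphi : phi K L N (ν N) ≤ c₃ * w :=
    phi_le K L hC hN0 h₁ h₂ hw0 hw1 hw4 hNw
  have hφ : varphi W N (ν N) ≤ η / 2 := by
    have h3 : varphi W N (ν N) ≤ c₄ * w ^ 2 := by
      rw [varphi, ← hηd, hc₄, mul_assoc]
      gcongr
    have h4 : c₄ * w ≤ η / 2 := by
      have := (hws.trans_le (min_le_right _ _)).le
      rw [le_div_iff₀ (by positivity)] at this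
      linarith
    nlinarith
  have hγφ : gamma W N (ν N) ≤ varphi W N (ν N) := by
    rw [gamma, ← hηd, ← div_div, Real.sqrt_div' _ hη.le, varphi, ← hηd, add_mul, one_div,
      div_eq_inv_mul]
    linarith [Real.sqrt_nonneg (Real.log (2 * N / ν N) / N)]
  have hN4 : 1 / (N : ℝ) ^ (1 / 4 : ℝ) ≤ w := by
    have h3 : 1 / (N : ℝ) ^ (1 / 4 : ℝ) = (1 / (N : ℝ)) ^ (1 / 4 : ℝ) := by
      rw [Real.div_rpow zero_le_one hN0.le, Real.one_rpow]
    rw [h3, hwd]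
    gcongr
  have hγ2 : η / 2 ≤ η - gamma W N (ν N) := by linarith
  have hφ2 : η / 2 ≤ η - varphi W N (ν N) := by linarith
  have hT : 0 ≤ opNorm W := hη.le.trans (hW.eta_le_opNorm hη)
  have hη2 : 0 < η / 2 := by positivity
  have hA : 1 / (N * (η - gamma W N (ν N))) ≤ 1 / N * (2 / η) := by
    have : 1 / (N : ℝ) * (2 / η) = 1 / (N * (η / 2)) := by field_simp
    rw [this]; gcongr
  have hB : (2 : ℝ) ^ (1 / 4 : ℝ) * √(opNorm W + phi K L N (ν N)) /
      ((N : ℝ) ^ (1 / 4 : ℝ) * (η - varphi W N (ν N))) ≤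
      (2 : ℝ) ^ (1 / 4 : ℝ) * √(opNorm W + c₃) * (2 / η) * w := by
    have h3 : phi K L N (ν N) ≤ c₃ := hphi.trans (mul_le_of_le_one_right hc₃0 hw1)
    calc (2 : ℝ) ^ (1 / 4 : ℝ) * √(opNorm W + phi K L N (ν N)) /
        ((N : ℝ) ^ (1 / 4 : ℝ) * (η - varphi W N (ν N)))
        ≤ (2 : ℝ) ^ (1 / 4 : ℝ) * √(opNorm W + c₃) / ((N : ℝ) ^ (1 / 4 : ℝ) * (η / 2)) := by
          gcongr
      _ = (2 : ℝ) ^ (1 / 4 : ℝ) * √(opNorm W + c₃) * (2 / η) * (1 / (N : ℝ) ^ (1 / 4 : ℝ)) := by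
          field_simp
      _ ≤ _ := by gcongr
  have hη3 : 0 < η - gamma W N (ν N) := by linarith
  have hη4 : 0 < η - varphi W N (ν N) := by linarith
  have hE0 : 0 ≤ errorBound W K L N (ν N) := by
    unfold errorBound
    positivity
  rw [Real.norm_of_nonneg hE0, hrhs, Real.norm_of_nonneg (by positivity)]
  unfold errorBound
  calc 1 / (N * (η - gamma W N (ν N))) * (1 / N + phi K L N (ν N) / δ +
        (2 : ℝ) ^ (1 / 4 : ℝ) * √(opNorm W + phi K L N (ν N)) /
          ((N : ℝ) ^ (1 / 4 : ℝ) * (η - varphi W N (ν N))))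
      ≤ 1 / N * (2 / η) * (w + c₃ * w / δ +
          (2 : ℝ) ^ (1 / 4 : ℝ) * √(opNorm W + c₃) * (2 / η) * w) := by
        have h3 : 1 / (N : ℝ) ≤ w :=
          hNw.trans (pow_le_of_le_one hw0.le hw1 (by norm_num))
        gcongr
    _ = _ := by ring

end Rate

end Graphon

/-! ### The theorem. -/

theorem theorem2 {W : unitInterval → unitInterval → ℝ} (hW : Graphon.IsGraphon W)
    {K : ℕ} {α : Fin (K + 2) → ℝ} {L : ℝ} (hPL : Graphon.IsPiecewiseLipschitz W K α L)
    (hη : 0 < Graphon.eta W) :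
    -- the error bound, with probability at least `1 - 3 ν`
    (∀ (N : ℕ) (ν : ℝ), 0 < N → 0 < ν → ν < Real.exp (-1) →
      (∀ k : Fin (K + 1), 2 / (N : ℝ) < α k.succ - α k.castSucc) →
      1 / (N : ℝ) * Real.log (2 * N / ν) + 1 / (N : ℝ) * (2 * K + 3 * L) < Graphon.maxDegree W →
      N * Real.exp (-(N : ℝ) / 5) < ν →
      Graphon.varphi W N ν < Graphon.eta W →
      ∀ {Ω : Type*} [MeasurableSpace Ω] (P : MeasureTheory.Measure Ω)
        [MeasureTheory.IsProbabilityMeasure P]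
        (X : Fin N → Ω → unitInterval) (G : Ω → SimpleGraph (Fin N)),
        Graphon.IsSampledGraph W N P X G →
        1 - 3 * ν ≤ P.real {ω | Graphon.averageResistance (G ω) ≠ ⊤ ∧
          |(Graphon.averageResistance (G ω)).toReal - Graphon.graphonResistance W N|
            ≤ Graphon.errorBound W K L N ν}) ∧
    -- the rate of the error bound, for constant `ν` and for `ν = 1 / N ^ a`
    (∀ ν : ℝ, 0 < ν → ν < Real.exp (-1) →
      (fun N : ℕ => Graphon.errorBound W K L N ν) =O[Filter.atTop]
        (fun N : ℕ => (Real.log N / (N : ℝ) ^ 5) ^ (1 / 4 : ℝ))) ∧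
    (∀ a : ℝ, 0 < a →
      (fun N : ℕ => Graphon.errorBound W K L N (1 / (N : ℝ) ^ a)) =O[Filter.atTop]
        (fun N : ℕ => (Real.log N / (N : ℝ) ^ 5) ^ (1 / 4 : ℝ))) := by
  have hlog : ∀ᶠ N : ℕ in Filter.atTop, 1 ≤ Real.log N ∧ (0 : ℝ) < N := by
    filter_upwards [Filter.eventually_ge_atTop 3] with N hN
    have hN' : (3 : ℝ) ≤ N := by exact_mod_cast hN
    refine ⟨?_, by linarith⟩
    rw [Real.le_log_iff_exp_le (by linarith)]
    linarith [Real.exp_one_lt_d9]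
  have hl2 : 0 ≤ Real.log 2 := Real.log_nonneg (by norm_num)
  have hl2' : Real.log 2 ≤ 1 := by linarith [Real.log_two_lt_d9]
  refine ⟨fun N ν hN hν hν1 _ _ _ hφ Ω _ P _ X G hG =>
    hG.one_sub_le_measureReal hW hη K L hN hν hν1 hφ, fun ν hν hν1 => ?_, fun a ha => ?_⟩
  · have hν0 : 0 ≤ -Real.log ν := by
      have : Real.log ν ≤ 0 := Real.log_nonpos hν.le
        (hν1.le.trans (Real.exp_le_one_iff.2 (by norm_num)))
      linarith
    -- Once log N ≥ 1, the constants log 2 ≤ 1 and -log ν are absorbed into multiples of log N. For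
    -- ν = N^(-a) below, -log ν = a log N, hence C = 2 + a.
    refine Graphon.errorBound_isBigO hW hη K L (C := 2 - Real.log ν) (by linarith) ?_ ?_
    · filter_upwards [hlog] with N hN
      rw [Real.log_div hN.2.ne' hν.ne']
      nlinarith [hN.1]
    · filter_upwards [hlog] with N hN
      rw [Real.log_div (mul_pos two_pos hN.2).ne' hν.ne', Real.log_mul two_ne_zero hN.2.ne']
      nlinarith [hN.1]
  · refine Graphon.errorBound_isBigO hW hη K L (C := 2 + a) (by linarith) ?_ ?_
    · filter_upwards [hlog] with N hN
      rw [div_div_eq_mul_div, div_one, Real.log_mul hN.2.ne' (Real.rpow_pos_of_pos hN.2 a).ne',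
        Real.log_rpow hN.2]
      nlinarith [hN.1]
    · filter_upwards [hlog] with N hN
      rw [div_div_eq_mul_div, div_one, Real.log_mul (mul_pos two_pos hN.2).ne'
        (Real.rpow_pos_of_pos hN.2 a).ne', Real.log_rpow hN.2, Real.log_mul two_ne_zero hN.2.ne']
      nlinarith [hN.1]
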